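/- \label{Prop-Scalar=Injectively-Ranked} Fix an infinite set $\mathsf{Var}$ of variables and a set $\mathsf{Act}$ of actions. A model $\mathcal M$ is a set $M$ with a relation $\stackrel{\tau}{\to}\subseteq M\times M$ for every $\tau\in\mathsf{Act}$; a valuation is a map $\mathsf{val}:\mathsf{Var}\to\mathcal P(M)$. \emph{Scalar countdown formulas} are given by $\phi ::= x \mid \top\mid\bot\mid\phi_1\vee\phi_2\mid\phi_1\wedge\phi_2\mid\mu^\alpha x.\phi\mid\nu^\alpha x.\phi\mid\langle\tau\rangle\phi\mid[\tau]\phi$, where $x\in\mathsf{Var}$, $\tau\in\mathsf{Act}$ and $\alpha$ is an ordinal or $\infty$. The set $[\![\phi]\!]^{\mathsf{val}}\subseteq M$ is defined as usual for variables and Boolean connectives, $[\![\langle\tau\rangle\phi]\!]^{\mathsf{val}}=\{m \mid \exists n\,(m\stackrel{\tau}{\to}n \wedge n\in[\![\phi]\!]^{\mathsf{val}})\}$, $[\![[\tau]\phi]\!]^{\mathsf{val}}=\{m \mid \forall n\,(m\stackrel{\tau}{\to}n \Rightarrow n\in[\![\phi]\!]^{\mathsf{val}})\}$, and, for $F(H)=[\![\phi]\!]^{\mathsf{val}[x\mapsto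 H]}$, $[\![\mu^\alpha x.\phi]\!]^{\mathsf{val}}=F^\alpha_\mu$ and $[\![\nu^\alpha x.\phi]\!]^{\mathsf{val}}=F^\alpha_\nu$, where $F^\alpha_\mu=\bigcup_{\beta<\alpha}F(F^\beta_\mu)$ and $F^\alpha_\nu=\bigcap_{\beta<\alpha}F(F^\beta_\nu)$ for ordinals $\alpha$, and $F^\infty_\mu$, $F^\infty_\nu$ are the least and the greatest fixpoint of $F$. A \emph{countdown game} has a set of positions divided between two players $\exists$ and $\forall$, an edge relation, a rank for every position in a finite linear order $\mathcal R$ divided between the two players, a set $\mathcal D\subseteq\mathcal R$ of nonstandard ranks, and an initial counter valuation $\mathsf{ctr}_I:\mathcal D\to\mathsf{Ord}$. Configurations are pairs of a position $v$ and a valuation $\mathsf{ctr}:\mathcal D\to\mathsf{Ord}$, marked as positional or countdown. From a positional configuration $(v,\mathsf{ctr})$ the owner of $v$ chooses an edge $(v,w)$ and the game moves to the countdown configuration $(w,\mathsf{ctr})$. From a countdown configuration $(v,\mathsf{ctr})$ the owner of $r=\mathrm{rank}(v)$ chooses $\mathsf{ctr}'$ with $\mathsf{ctr}'(r')=\mathsf{ctr}_I(r')$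 for $r'<r$, $\mathsf{ctr}'(r)<\mathsf{ctr}(r)$ if $r\in\mathcal D$, and $\mathsf{ctr}'(r')=\mathsf{ctr}(r')$ for $r'>r$, and the game moves to the positional configuration $(v,\mathsf{ctr}')$. A player who has to move but cannot loses; in an infinite play the owner of the greatest rank appearing infinitely often loses. Strategies are partial maps from finite plays to moves. A \emph{countdown automaton} consists of a finite set $Q$ of states divided between the two players, an initial state $q_I$, a function $\delta$ assigning to each state either a finite subset of $Q\sqcup\mathsf{Var}$ or an element of $\mathsf{Act}\times(Q\sqcup\mathsf{Var})$, a map $\mathrm{rank}:Q\to\mathcal R$, and $\mathcal R,\mathcal D,\mathsf{ctr}_I$ as in a countdown game. It is \emph{injectively ranked} if any two different states have different ranks. Its semantic game in $\mathcal M$ under $\mathsf{val}$ has positions $M\times(Q\sqcup\mathsf{Var})$; a position $(m,q)$ with $q\in Q$ has the owner and rank of $q$, and edges to all $(m,z)$ with $z\in\delta(q)$ if $\delta(q)\subseteq Q\sqcup\mathsf{Var}$, and to all $(n,p)$ with $m\stackrel{\tau}{\to}n$ if $\delta(q)=(\tau,p)$. A position $(m,x)$ with $x\in\mathsf{Var}$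 has no outgoing edges, belongs to $\forall$ if $m\in\mathsf{val}(x)$ and to $\exists$ otherwise, and has an additional standard rank, lower than all ranks in $\mathcal R$. The language $[\![\mathcal A]\!]^{\mathsf{val}}$ is the set of all $m\in M$ such that $\exists$ has a winning strategy from the positional configuration $((m,q_I),\mathsf{ctr}_I)$. \textbf{Proposition.} Scalar countdown formulas and injectively ranked countdown automata have equal expressive power: (1) for every scalar countdown formula $\phi$ there is an injectively ranked countdown automaton $\mathcal A$ such that $[\![\phi]\!]^{\mathsf{val}}=[\![\mathcal A]\!]^{\mathsf{val}}$ for every model $\mathcal M$ and every valuation $\mathsf{val}$; and (2) for every injectively ranked countdown automaton $\mathcal A$ there is a scalar countdown formula $\phi$ such that $[\![\phi]\!]^{\mathsf{val}}=[\![\mathcal A]\!]^{\mathsf{val}}$ for every model $\mathcal M$ and every valuation $\mathsf{val}$. -/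

import Mathlib

universe u v w z

namespace Countdown

/-! ### Models and scalar countdown formulas -/

/-- A model for a set `Act` of actions: a set of points with one binary relation per action. -/
structure Model (Act : Type v) where
  /-- The points of the model. -/
  Point : Type z
  /-- `trans τ m n` means that there is a `τ`-labelled transition from `m` to `n`. -/
  trans : Act → Point → Point → Prop

/-- Scalar countdown formulas. The decorations of the fixpoint operators are elements of
`WithTop Ordinal`, i.e. ordinals or the extra greatest element `⊤` (written `∞` on paper). -/
inductive ScalarFormula (Var : Type u) (Act : Type v) : Type (max u v (w + 1))
  | var (x : Var) : ScalarFormula Var Act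
  | top : ScalarFormula Var Act
  | bot : ScalarFormula Var Act
  | or (φ ψ : ScalarFormula Var Act) : ScalarFormula Var Act
  | and (φ ψ : ScalarFormula Var Act) : ScalarFormula Var Act
  | mu (α : WithTop Ordinal.{w}) (x : Var) (φ : ScalarFormula Var Act) : ScalarFormula Var Act
  | nu (α : WithTop Ordinal.{w}) (x : Var) (φ : ScalarFormula Var Act) : ScalarFormula Var Act
  | dia (τ : Act) (φ : ScalarFormula Var Act) : ScalarFormula Var Act
  | box (τ : Act) (φ : ScalarFormula Var Act) : ScalarFormula Var Act

/-- The increasing approximations `F^α_μ = ⨆_{β < α} F (F^β_μ)` for ordinals `α`. -/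
noncomputable def muIter {A : Type z} [CompleteLattice A] (F : A → A) (α : Ordinal.{w}) : A :=
  ⨆ β : Set.Iio α, F (muIter F β.1)
termination_by α
decreasing_by exact β.2

/-- The decreasing approximations `F^α_ν = ⨅_{β < α} F (F^β_ν)` for ordinals `α`. -/
noncomputable def nuIter {A : Type z} [CompleteLattice A] (F : A → A) (α : Ordinal.{w}) : A :=
  ⨅ β : Set.Iio α, F (nuIter F β.1)
termination_by α
decreasing_by exact β.2

/-- `F^α_μ` for `α` an ordinal or `∞`; `F^∞_μ` is the least fixpoint of the monotone map `F`
(see `isLeast_muApprox_top`). -/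
noncomputable def muApprox {A : Type z} [CompleteLattice A] (F : A → A) :
    WithTop Ordinal.{w} → A
  | none => sInf {a | F a ≤ a}
  | some α => muIter F α

/-- `F^α_ν` for `α` an ordinal or `∞`; `F^∞_ν` is the greatest fixpoint of the monotone map `F`
(see `isGreatest_nuApprox_top`). -/
noncomputable def nuApprox {A : Type z} [CompleteLattice A] (F : A → A) :
    WithTop Ordinal.{w} → A
  | none => sSup {a | a ≤ F a}
  | some α => nuIter F α

theorem isLeast_muApprox_top {A : Type z} [CompleteLattice A] (F : A → A) (hF : Monotone F) :
    IsLeast {a | F a = a} (muApprox F (⊤ : WithTop Ordinal.{w})) :=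
  OrderHom.isLeast_lfp (⟨F, hF⟩ : A →o A)

theorem isGreatest_nuApprox_top {A : Type z} [CompleteLattice A] (F : A → A) (hF : Monotone F) :
    IsGreatest {a | F a = a} (nuApprox F (⊤ : WithTop Ordinal.{w})) :=
  OrderHom.isGreatest_gfp (⟨F, hF⟩ : A →o A)

open Classical in
/-- The set of points at which a scalar countdown formula holds, under a valuation. -/
noncomputable def ScalarFormula.sem {Var : Type u} {Act : Type v} (K : Model.{v, z} Act) :
    ScalarFormula.{u, v, w} Var Act → (Var → Set K.Point) → Set K.Point
  | .var x, val => val x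
  | .top, _ => Set.univ
  | .bot, _ => ∅
  | .or φ ψ, val => φ.sem K val ∪ ψ.sem K val
  | .and φ ψ, val => φ.sem K val ∩ ψ.sem K val
  | .mu α x φ, val => muApprox (fun H => φ.sem K (Function.update val x H)) α
  | .nu α x φ, val => nuApprox (fun H => φ.sem K (Function.update val x H)) α
  | .dia τ φ, val => {m | ∃ n, K.trans τ m n ∧ n ∈ φ.sem K val}
  | .box τ φ, val => {m | ∀ n, K.trans τ m n → n ∈ φ.sem K val}

/-! ### Countdown games -/

/-- The two players, ∃ve and ∀dam. -/
inductive Player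
  | eve
  | adam

/-- A countdown game with set of positions `V` and (finite, linearly ordered) set of ranks `R`. -/
structure Game (V : Type u) (R : Type v) [LinearOrder R] [Finite R] where
  /-- The owner of each position. -/
  owner : V → Player
  /-- The edge relation. -/
  edge : V → V → Prop
  /-- The rank of each position. -/
  rank : V → R
  /-- The owner of each rank. -/
  rankOwner : R → Player
  /-- The set of nonstandard ranks. -/
  nonstd : Set R
  /-- The initial counter valuation, defined on the nonstandard ranks. -/
  ctrI : nonstd → Ordinal.{w}

/-- Configurations of a game with set of positions `V` and set of nonstandard ranks `D`:
positional and countdown ones. -/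
inductive Config (V : Type u) {R : Type v} (D : Set R)
  | positional (v : V) (ctr : D → Ordinal.{w})
  | countdown (v : V) (ctr : D → Ordinal.{w})

/-- The position of a configuration. -/
def Config.pos {V : Type u} {R : Type v} {D : Set R} : Config.{u, v, w} V D → V
  | .positional v _ => v
  | .countdown v _ => v

section

variable {V : Type u} {R : Type v} [LinearOrder R] [Finite R]

/-- The player responsible for the next move. -/
def Game.mover (G : Game.{u, v, w} V R) : Config.{u, v, w} V G.nonstd → Player
  | .positional v _ => G.owner v
  | .countdown v _ => G.rankOwner (G.rank v)

/-- The legal moves between configurations. -/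
inductive Game.Step (G : Game.{u, v, w} V R) :
    Config.{u, v, w} V G.nonstd → Config.{u, v, w} V G.nonstd → Prop
  | move (v v' : V) (ctr : G.nonstd → Ordinal.{w}) (he : G.edge v v') :
      G.Step (.positional v ctr) (.countdown v' ctr)
  | count (v : V) (ctr ctr' : G.nonstd → Ordinal.{w})
      (hlt : ∀ r : G.nonstd, r.1 < G.rank v → ctr' r = G.ctrI r)
      (heq : ∀ r : G.nonstd, r.1 = G.rank v → ctr' r < ctr r)
      (hgt : ∀ r : G.nonstd, G.rank v < r.1 → ctr' r = ctr r) :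
      G.Step (.countdown v ctr) (.positional v ctr')

/-- A strategy: a partial function from finite plays (nonempty lists of configurations, in
chronological order) to moves (the next configuration). -/
abbrev Game.Strategy (G : Game.{u, v, w} V R) : Type (max u v (w + 1)) :=
  List (Config.{u, v, w} V G.nonstd) → Option (Config.{u, v, w} V G.nonstd)

/-- `G.FinPlay P σ γ π`: the list `π` is a finite play that starts in `γ` and is consistent with
the strategy `σ` of player `P`. -/
inductive Game.FinPlay (G : Game.{u, v, w} V R) (P : Player) (σ : G.Strategy)
    (γ : Config.{u, v, w} V G.nonstd) : List (Config.{u, v, w} V G.nonstd) → Prop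
  | init : G.FinPlay P σ γ [γ]
  | step (π : List (Config.{u, v, w} V G.nonstd)) (c d : Config.{u, v, w} V G.nonstd)
      (hπ : G.FinPlay P σ γ (π ++ [c])) (hcd : G.Step c d)
      (hσ : G.mover c = P → σ (π ++ [c]) = some d) : G.FinPlay P σ γ (π ++ [c] ++ [d])

/-- Rank `r` appears infinitely often in the sequence `ρ`. -/
def Game.InfOften (G : Game.{u, v, w} V R) (ρ : ℕ → Config.{u, v, w} V G.nonstd) (r : R) : Prop :=
  ∃ᶠ n in Filter.atTop, G.rank (ρ n).pos = r

/-- The infinite play `ρ` is won by `P`: the greatest rank appearing infinitely often in `ρ` is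
owned by the opponent of `P`. -/
def Game.WinsInf (G : Game.{u, v, w} V R) (P : Player)
    (ρ : ℕ → Config.{u, v, w} V G.nonstd) : Prop :=
  ∃ r, IsGreatest {r' | G.InfOften ρ r'} r ∧ G.rankOwner r ≠ P

/-- The strategy `σ` of player `P` is winning from `γ`: in every finite consistent play in which
`P` has to move, `σ` provides a legal move (so that `P` never gets stuck), and every infinite
consistent play is won by `P`. -/
def Game.IsWinning (G : Game.{u, v, w} V R) (P : Player) (σ : G.Strategy)
    (γ : Config.{u, v, w} V G.nonstd) : Prop :=
  (∀ π c, G.FinPlay P σ γ (π ++ [c]) → G.mover c = P →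
    ∃ d, σ (π ++ [c]) = some d ∧ G.Step c d) ∧
  ∀ ρ : ℕ → Config.{u, v, w} V G.nonstd,
    (∀ n, G.FinPlay P σ γ ((List.range (n + 1)).map ρ)) → G.WinsInf P ρ

/-- Player `P` wins from the configuration `γ`. -/
def Game.Wins (G : Game.{u, v, w} V R) (P : Player) (γ : Config.{u, v, w} V G.nonstd) : Prop :=
  ∃ σ : G.Strategy, G.IsWinning P σ γ

end

/-! ### Countdown automata -/

/-- Countdown automata over variables `Var` and actions `Act`. -/
structure Automaton (Var : Type u) (Act : Type v) where
  /-- The states. -/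
  Q : Type
  [finiteQ : Finite Q]
  /-- The ranks. -/
  R : Type
  [linearOrderR : LinearOrder R]
  [finiteR : Finite R]
  /-- The owner of each state. -/
  owner : Q → Player
  /-- The initial state. -/
  qI : Q
  /-- The transition function: `ε`-transitions to a finite set of states and variables, or a
  modal transition. -/
  δ : Q → Finset (Q ⊕ Var) ⊕ (Act × (Q ⊕ Var))
  /-- The rank of each state. -/
  rank : Q → R
  /-- The owner of each rank. -/
  rankOwner : R → Player
  /-- The set of nonstandard ranks. -/
  nonstd : Set R
  /-- The initial counter valuation, defined on the nonstandard ranks. -/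
  ctrI : nonstd → Ordinal.{w}

attribute [instance] Automaton.finiteQ Automaton.linearOrderR Automaton.finiteR

section

variable {Var : Type u} {Act : Type v}

/-- Any two different states have different ranks. -/
def Automaton.InjectivelyRanked (A : Automaton.{u, v, w} Var Act) : Prop :=
  Function.Injective A.rank

/-- The edges of the semantic game. -/
def Automaton.edge (A : Automaton.{u, v, w} Var Act) (K : Model.{v, z} Act) :
    K.Point × (A.Q ⊕ Var) → K.Point × (A.Q ⊕ Var) → Prop
  | (m, .inl q), (n, s) =>
    match A.δ q with
    | .inl S => n = m ∧ s ∈ S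
    | .inr (τ, p) => K.trans τ m n ∧ s = p
  | (_, .inr _), _ => False

open Classical in
/-- The owners of positions in the semantic game: a position with a variable belongs to ∀dam if
the valuation makes the variable true there, and to ∃ve otherwise. -/
noncomputable def Automaton.posOwner (A : Automaton.{u, v, w} Var Act) (K : Model.{v, z} Act)
    (val : Var → Set K.Point) : K.Point × (A.Q ⊕ Var) → Player
  | (_, .inl q) => A.owner q
  | (m, .inr x) => if m ∈ val x then .adam else .eve

/-- The semantic game of an automaton in a model under a valuation. The ranks are those of the
automaton and an additional lowest standard rank `⊥`, given to the (terminal) positions with a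
variable; hence no counter is touched there. -/
noncomputable def Automaton.game (A : Automaton.{u, v, w} Var Act) (K : Model.{v, z} Act)
    (val : Var → Set K.Point) : Game.{max u z, 0, w} (K.Point × (A.Q ⊕ Var)) (WithBot A.R) where
  owner := A.posOwner K val
  edge := A.edge K
  rank
    | (_, .inl q) => (A.rank q : WithBot A.R)
    | (_, .inr _) => ⊥
  rankOwner
    | none => .eve
    | some r => A.rankOwner r
  nonstd := {s | match s with
    | none => False
    | some r => r ∈ A.nonstd}
  ctrI
    | ⟨none, h⟩ => h.elim
    | ⟨some r, h⟩ => A.ctrI ⟨r, h⟩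

/-- The language of an automaton: the points from which ∃ve wins the semantic game, starting in
the positional configuration with the initial state and the initial counter valuation. -/
def Automaton.language (A : Automaton.{u, v, w} Var Act) (K : Model.{v, z} Act)
    (val : Var → Set K.Point) : Set K.Point :=
  {m | (A.game K val).Wins .eve (.positional (m, .inl A.qI) (A.game K val).ctrI)}

end

end Countdown

universe y

namespace Countdown


/-! ### Approximations -/

section Approx

/-! Both translations rest on one description of the language (`Automaton.language_eq`). List the
states from the highest to the lowest rank; the winning regions then solve a nested system of
fixpoint equations (`nest`), with one unknown per state, bound by the approximation operator of the
owner of its rank. As ranks are injective, a counter belongs to at most one state, so a counter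
valuation amounts to a bound c(q) for every q. In the scope of the unknown q, all later unknowns
carry their initial bounds, because a countdown at q resets the lower counters. Hence
(`Automaton.exists_solution_eq`) the value at q is an approximation F^{c(q)}, where F depends only
on the higher counters, and lowering the counter to b turns a claim about F^{c(q)} into one about
F(F^b).

A player who is right about membership wins by keeping her claim true. At her own ranks she can
choose a smaller bound with the claim intact; at the opponent's ranks any smaller bound preserves
it. A standard rank of her own carries a fictitious bound, which becomes an ordinal once counted
down, since ordinal approximations exhaust a least fixpoint (`mem_muApprox`); a standard rank of the
opponent keeps the bound ∞. These bounds form a signature that excludes losing infinite plays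
(`Game.winsInf_of_progress`). Complementation exchanges the players, so points outside the solution
are won by ∀dam; as both players cannot win, no determinacy theorem is needed.

An automaton then becomes a formula by eliminating the unknowns with fresh variables
(`Automaton.sem_formula`). A formula becomes a system of equations by structural induction, every
connective contributing a new state of highest rank (`ScalarFormula.hasSystem`). -/

theorem muApprox_coe {A : Type z} [CompleteLattice A] (F : A → A) (α : Ordinal.{w}) :
    muApprox F (α : WithTop Ordinal.{w}) = ⨆ β : Set.Iio α, F (muApprox F (β.1 : WithTop _)) := by
  change muIter F α = ⨆ β : Set.Iio α, F (muIter F β.1)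
  rw [muIter]

theorem nuApprox_coe {A : Type z} [CompleteLattice A] (F : A → A) (α : Ordinal.{w}) :
    nuApprox F (α : WithTop Ordinal.{w}) = ⨅ β : Set.Iio α, F (nuApprox F (β.1 : WithTop _)) := by
  change nuIter F α = ⨅ β : Set.Iio α, F (nuIter F β.1)
  rw [nuIter]

theorem muApprox_top {A : Type z} [CompleteLattice A] (F : A → A) :
    muApprox F (⊤ : WithTop Ordinal.{w}) = sInf {a | F a ≤ a} := rfl

theorem nuApprox_top {A : Type z} [CompleteLattice A] (F : A → A) :
    nuApprox F (⊤ : WithTop Ordinal.{w}) = sSup {a | a ≤ F a} := rfl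

/-- Approximations of the greatest fixpoint are dual to those of the least one. -/
theorem compl_nuApprox {X : Type z} (F : Set X → Set X) (a : WithTop Ordinal.{w}) :
    (nuApprox F a)ᶜ = muApprox (fun H => (F Hᶜ)ᶜ) a := by
  induction a with
  | top =>
    rw [nuApprox_top, muApprox_top]
    ext m
    simp only [Set.sSup_eq_sUnion, Set.sInf_eq_sInter, Set.mem_compl_iff, Set.mem_sUnion,
      Set.mem_sInter, Set.mem_ofPred_eq, not_exists, not_and]
    constructor
    · intro h H hH
      by_contra hm
      exact h Hᶜ (Set.compl_subset_comm.1 hH) hm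
    · intro h H hH hm
      exact h Hᶜ (by rw [compl_compl]; exact Set.compl_subset_compl.2 hH) hm
  | coe α =>
    induction α using WellFoundedLT.induction with
    | ind α ih =>
      rw [nuApprox_coe, muApprox_coe, compl_iInf]
      refine iSup_congr fun β => ?_
      rw [← ih β.1 β.2, compl_compl]

theorem mem_muApprox_coe {X : Type z} {F : Set X → Set X} {α : Ordinal.{w}} {m : X} :
    m ∈ muApprox F (α : WithTop Ordinal.{w}) ↔
      ∃ β < α, m ∈ F (muApprox F (β : WithTop Ordinal.{w})) := by
  rw [muApprox_coe]
  simp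

theorem mem_nuApprox_coe {X : Type z} {F : Set X → Set X} {α : Ordinal.{w}} {m : X} :
    m ∈ nuApprox F (α : WithTop Ordinal.{w}) ↔
      ∀ β < α, m ∈ F (nuApprox F (β : WithTop Ordinal.{w})) := by
  rw [nuApprox_coe]
  simp

theorem muApprox_coe_mono {X : Type z} (F : Set X → Set X) {α β : Ordinal.{w}} (h : α ≤ β) :
    muApprox F (α : WithTop Ordinal.{w}) ⊆ muApprox F (β : WithTop Ordinal.{w}) := by
  intro m
  rw [mem_muApprox_coe, mem_muApprox_coe]
  rintro ⟨γ, hγ, hm⟩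
  exact ⟨γ, hγ.trans_le h, hm⟩

/-- The least fixpoint is exhausted by its approximations. -/
theorem mem_muApprox {X : Type z} {F : Set X → Set X} (hF : Monotone F)
    {a : WithTop Ordinal.{max w z}} {m : X} (hm : m ∈ muApprox F a) :
    ∃ b < a, m ∈ F (muApprox F b) := by
  induction a with
  | coe α =>
    obtain ⟨β, hβ, h⟩ := mem_muApprox_coe.1 hm
    exact ⟨β, WithTop.coe_lt_coe.2 hβ, h⟩
  | top =>
    -- The union of all ordinal stages is a prefixpoint. The stages at which its points enter form a
    -- family indexed by a type in `Type z`, which is bounded in `Ordinal.{max w z}`; this is the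
    -- reason for the universe of `a`.
    let S : Set X := {m | ∃ β : Ordinal.{max w z}, m ∈ muApprox F (β : WithTop Ordinal.{max w z})}
    have hS : F S ⊆ S := by
      choose f hf using fun m : S => m.2
      have hb : BddAbove (Set.range f) := Ordinal.bddAbove_of_small
      have hle : S ⊆ muApprox F ((⨆ m, f m : Ordinal.{max w z}) : WithTop Ordinal.{max w z}) :=
        fun m hm => muApprox_coe_mono F (le_ciSup hb ⟨m, hm⟩) (hf ⟨m, hm⟩)
      intro m hm
      exact ⟨Order.succ (⨆ m, f m), mem_muApprox_coe.2 ⟨_, Order.lt_succ _, hF hle hm⟩⟩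
    rw [muApprox_top] at hm
    obtain ⟨α, hα⟩ := (sInf_le hS : sInf {a | F a ≤ a} ≤ S) hm
    obtain ⟨β, -, h⟩ := mem_muApprox_coe.1 hα
    exact ⟨β, WithTop.coe_lt_top _, h⟩

/-- From ∞ one may pass to any ordinal, since the greatest fixpoint lies below every ordinal stage,
or stay at ∞, since it is a fixpoint. The second case models the opponent's standard ranks. -/
theorem mem_map_nuApprox {X : Type z} {F : Set X → Set X} (hF : Monotone F)
    {a b : WithTop Ordinal.{w}} {m : X} (hm : m ∈ nuApprox F a)
    (hb : b < a ∨ a = ⊤ ∧ b = ⊤) : m ∈ F (nuApprox F b) := by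
  rcases hb with hb | ⟨rfl, rfl⟩
  · induction b with
    | top => exact absurd hb not_top_lt
    | coe β =>
      induction a with
      | coe α => exact mem_nuApprox_coe.1 hm β (WithTop.coe_lt_coe.1 hb)
      | top =>
        rw [← (isGreatest_nuApprox_top F hF).1] at hm
        refine hF ?_ hm
        clear hm hb
        induction β using WellFoundedLT.induction with
        | ind β ih =>
          intro n hn
          refine mem_nuApprox_coe.2 fun γ hγ => ?_
          rw [← (isGreatest_nuApprox_top F hF).1] at hn
          exact hF (ih γ hγ) hn
  · rwa [(isGreatest_nuApprox_top F hF).1]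

theorem monotone_compl_conj {X : Type z} {F : Set X → Set X} (hF : Monotone F) :
    Monotone fun H => (F Hᶜ)ᶜ :=
  fun _ _ h => Set.compl_subset_compl.2 (hF (Set.compl_subset_compl.2 h))

/-- The approximations for which a given player is responsible. -/
noncomputable def approx {A : Type z} [CompleteLattice A] (P : Player) (F : A → A)
    (a : WithTop Ordinal.{w}) : A :=
  match P with
  | .eve => muApprox F a
  | .adam => nuApprox F a

/-- A statement claimed by ∃ve or refuted by ∀dam. -/
def Player.Claims (P : Player) (p : Prop) : Prop :=
  match P with
  | .eve => p
  | .adam => ¬p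

theorem not_mem_nuApprox {X : Type z} {F : Set X → Set X} {a : WithTop Ordinal.{w}} {m : X} :
    m ∉ nuApprox F a ↔ m ∈ muApprox (fun H => (F Hᶜ)ᶜ) a := by
  rw [← compl_nuApprox, Set.mem_compl_iff]

theorem not_mem_muApprox {X : Type z} {F : Set X → Set X} {a : WithTop Ordinal.{w}} {m : X} :
    m ∉ muApprox F a ↔ m ∈ nuApprox (fun H => (F Hᶜ)ᶜ) a := by
  rw [← not_iff_not, not_not, not_mem_nuApprox]
  simp

/-- The player responsible for an approximation that she claims can decrease the bound. -/
theorem claims_approx_self {X : Type z} {F : Set X → Set X} (hF : Monotone F) {P : Player}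
    {a : WithTop Ordinal.{max w z}} {m : X} (hm : P.Claims (m ∈ approx P F a)) :
    ∃ b < a, P.Claims (m ∈ F (approx P F b)) := by
  cases P with
  | eve => exact mem_muApprox.{w} hF hm
  | adam =>
    obtain ⟨b, hb, h⟩ := mem_muApprox.{w} (monotone_compl_conj hF) (not_mem_nuApprox.1 hm)
    rw [← compl_nuApprox, compl_compl] at h
    exact ⟨b, hb, h⟩

/-- A claim about an approximation for which the opponent is responsible persists when the bound
decreases. -/
theorem claims_approx_other {X : Type z} {F : Set X → Set X} (hF : Monotone F) {P P' : Player}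
    (hP : P' ≠ P) {a b : WithTop Ordinal.{w}} {m : X} (hm : P.Claims (m ∈ approx P' F a))
    (hb : b < a ∨ a = ⊤ ∧ b = ⊤) : P.Claims (m ∈ F (approx P' F b)) := by
  cases P <;> cases P' <;> first | exact absurd rfl hP | skip
  · exact mem_map_nuApprox hF hm hb
  · have h := mem_map_nuApprox (monotone_compl_conj hF) (not_mem_muApprox.1 hm) hb
    have h' : (nuApprox (fun H => (F Hᶜ)ᶜ) b)ᶜ = muApprox F b := by
      rw [compl_nuApprox]; simp
    rw [h'] at h
    exact h

theorem muApprox_mono {X : Type z} {F G : Set X → Set X} (hF : Monotone F) (h : F ≤ G)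
    (a : WithTop Ordinal.{w}) : muApprox F a ≤ muApprox G a := by
  induction a with
  | top => exact sInf_le_sInf fun H hH => (h H).trans hH
  | coe α =>
    induction α using WellFoundedLT.induction with
    | ind α ih =>
      rw [muApprox_coe, muApprox_coe]
      exact iSup_mono fun β => (hF (ih β.1 β.2)).trans (h _)

theorem nuApprox_mono {X : Type z} {F G : Set X → Set X} (hF : Monotone F) (h : F ≤ G)
    (a : WithTop Ordinal.{w}) : nuApprox F a ≤ nuApprox G a := by
  induction a with
  | top => exact sSup_le_sSup fun H hH => le_trans hH (h H)
  | coe α =>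
    induction α using WellFoundedLT.induction with
    | ind α ih =>
      rw [nuApprox_coe, nuApprox_coe]
      exact iInf_mono fun β => (hF (ih β.1 β.2)).trans (h _)

theorem approx_mono {X : Type z} {F G : Set X → Set X} (hF : Monotone F) (h : F ≤ G)
    (P : Player) (a : WithTop Ordinal.{w}) : approx P F a ≤ approx P G a := by
  cases P
  · exact muApprox_mono hF h a
  · exact nuApprox_mono hF h a

theorem approx_const_top {X : Type z} (P : Player) (S : Set X) :
    approx P (fun _ => S) (⊤ : WithTop Ordinal.{w}) = S := by
  cases P
  · exact (isLeast_muApprox_top _ monotone_const).1.symm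
  · exact (isGreatest_nuApprox_top _ monotone_const).1.symm

/-- Everything below a lifted ordinal is itself a lift, so the two recursions run through the same
stages. This allows counters to be compared with closure ordinals of a larger universe. -/
theorem muApprox_lift {X : Type z} (F : Set X → Set X) (a : WithTop Ordinal.{w}) :
    muApprox F (a.map Ordinal.lift.{u}) = muApprox F a := by
  induction a with
  | top => rfl
  | coe α =>
    rw [WithTop.map_coe]
    induction α using WellFoundedLT.induction with
    | ind α ih =>
      ext m
      rw [mem_muApprox_coe, mem_muApprox_coe]
      constructor
      · rintro ⟨β, hβ, h⟩
        obtain ⟨γ, rfl⟩ := Ordinal.mem_range_lift_of_le hβ.le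
        rw [Ordinal.lift_lt] at hβ
        exact ⟨γ, hβ, by rwa [ih γ hβ] at h⟩
      · rintro ⟨γ, hγ, h⟩
        exact ⟨_, Ordinal.lift_lt.2 hγ, by rwa [ih γ hγ]⟩

theorem approx_lift {X : Type z} (P : Player) (F : Set X → Set X) (a : WithTop Ordinal.{w}) :
    approx P F (a.map Ordinal.lift.{u}) = approx P F a := by
  cases P with
  | eve => exact muApprox_lift F a
  | adam =>
    refine compl_injective ?_
    exact (compl_nuApprox F _).trans ((muApprox_lift _ a).trans (compl_nuApprox F a).symm)

end Approx

/-! ### Nested fixpoints -/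

section Nest

open scoped Classical

/-- The solution of a nested system of fixpoint equations. The unknowns in the list, the outermost
one first, are bound by the operators `ap`, except that within the scope of an unknown, the later
ones are bound by `ap₀`. -/
noncomputable def nest {Q : Type u} {Y : Type v} {X : Type z} (D : Q → (Q ⊕ Y → X) → X)
    (ap₀ : Q → (X → X) → X) : (Q → (X → X) → X) → List Q → (Q ⊕ Y → X) → Q ⊕ Y → X
  | _, [], e => e
  | ap, q :: l, e => nest D ap₀ ap l (Function.update e (.inl q)
      (ap q fun H => D q (nest D ap₀ ap₀ l (Function.update e (.inl q) H))))

variable {Q : Type u} {Y : Type v} {X : Type z} {D : Q → (Q ⊕ Y → X) → X}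
  {ap₀ : Q → (X → X) → X}

/-- The definition fixes a classical decidability instance; this unfolding is available for any
instance. -/
theorem nest_cons [DecidableEq (Q ⊕ Y)] (ap : Q → (X → X) → X) (q : Q) (l : List Q)
    (e : Q ⊕ Y → X) : nest D ap₀ ap (q :: l) e = nest D ap₀ ap l (Function.update e (.inl q)
      (ap q fun H => D q (nest D ap₀ ap₀ l (Function.update e (.inl q) H)))) := by
  rw [nest]
  congr!

theorem nest_of_notMem {ap : Q → (X → X) → X} {l : List Q} {e : Q ⊕ Y → X} {s : Q ⊕ Y}
    (h : ∀ q ∈ l, s ≠ .inl q) : nest D ap₀ ap l e s = e s := by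
  induction l generalizing e with
  | nil => rfl
  | cons q l ih =>
    rw [nest, ih fun p hp => h p (List.mem_cons_of_mem _ hp),
      Function.update_of_ne (h q List.mem_cons_self)]

theorem nest_congr_ap {ap ap' : Q → (X → X) → X} {l : List Q} (h : ∀ q ∈ l, ap q = ap' q)
    (e : Q ⊕ Y → X) : nest D ap₀ ap l e = nest D ap₀ ap' l e := by
  induction l generalizing e with
  | nil => rfl
  | cons q l ih =>
    rw [nest, nest, ih fun p hp => h p (List.mem_cons_of_mem _ hp), h q List.mem_cons_self]

/-- Only the values at the elements that the equations refer to matter. -/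
theorem nest_congr_env {T : Set (Q ⊕ Y)}
    (hD : ∀ q e e', Set.EqOn e e' T → D q e = D q e') {ap : Q → (X → X) → X} {l : List Q}
    {e e' : Q ⊕ Y → X} (h : Set.EqOn e e' T) :
    Set.EqOn (nest D ap₀ ap l e) (nest D ap₀ ap l e') T := by
  induction l generalizing e e' ap with
  | nil => exact h
  | cons q l ih =>
    have hu : ∀ H, Set.EqOn (Function.update e (.inl q) H) (Function.update e' (.inl q) H) T := by
      intro H s hs
      by_cases hq : s = .inl q
      · subst hq; simp
      · simp only [Function.update_of_ne hq]; exact h hs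
    rw [nest, nest]
    have hF : (fun H => D q (nest D ap₀ ap₀ l (Function.update e (.inl q) H))) =
        fun H => D q (nest D ap₀ ap₀ l (Function.update e' (.inl q) H)) :=
      funext fun H => hD q _ _ (ih (hu H))
    rw [hF]
    exact ih (hu _)

/-- Focus on one unknown. -/
theorem exists_nest_append {ap : Q → (X → X) → X} (l₁ l₂ : List Q) (e : Q ⊕ Y → X) :
    ∃ e', ∀ ap', (∀ q ∈ l₁, ap' q = ap q) →
      nest D ap₀ ap' (l₁ ++ l₂) e = nest D ap₀ ap' l₂ e' := by
  induction l₁ generalizing e with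
  | nil => exact ⟨e, fun _ _ => rfl⟩
  | cons q l ih =>
    obtain ⟨e', he'⟩ := ih (Function.update e (.inl q)
      (ap q fun H => D q (nest D ap₀ ap₀ (l ++ l₂) (Function.update e (.inl q) H))))
    refine ⟨e', fun ap' h => ?_⟩
    rw [List.cons_append, nest, h q List.mem_cons_self]
    exact he' ap' fun p hp => h p (List.mem_cons_of_mem _ hp)

/-- A smaller system sits inside a larger one via `f`, which is injective with partial inverse `pf`,
and `g` renames its states and variables. Unknowns of the larger list outside the range of `f` are
never seen through `g`, so dropping them changes nothing. This yields the embeddings into disjoint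
unions and into extensions by a new state. -/
theorem nest_simulation {Q' : Type*} {Y' : Type*} {D' : Q' → (Q' ⊕ Y' → X) → X}
    {ap₀' : Q' → (X → X) → X} {f : Q → Q'} {g : Q ⊕ Y → Q' ⊕ Y'} {pf : Q' → Option Q}
    (hpf : ∀ q q', pf q' = some q ↔ f q = q') (hD : ∀ q e', D' (f q) e' = D q (e' ∘ g))
    (hap₀ : ∀ q, ap₀' (f q) = ap₀ q) {ap' : Q' → (X → X) → X} {ap : Q → (X → X) → X}
    (hap : ∀ q, ap' (f q) = ap q) {l : List Q'}
    (hg : ∀ q' ∈ l, ∀ s, g s = .inl q' ↔ ∃ q, s = .inl q ∧ f q = q') (e' : Q' ⊕ Y' → X) :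
    nest D' ap₀' ap' l e' ∘ g = nest D ap₀ ap (l.filterMap pf) (e' ∘ g) := by
  induction l generalizing e' ap ap' with
  | nil => rfl
  | cons q' l ih =>
    have hg' := fun p hp => hg p (List.mem_cons_of_mem q' hp)
    rw [nest, ih hap hg']
    cases h : pf q' with
    | none =>
      rw [List.filterMap_cons_none h]
      congr 1
      ext s
      have : g s ≠ .inl q' := by
        rw [Ne, hg q' List.mem_cons_self]
        rintro ⟨q, -, hq⟩
        rw [← hpf, h] at hq
        cases hq
      simp [Function.update_of_ne this]
    | some q =>
      rw [List.filterMap_cons_some h, nest]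
      obtain rfl := (hpf q q').1 h
      have hu : ∀ H, Function.update e' (.inl (f q)) H ∘ g =
          Function.update (e' ∘ g) (.inl q) H := by
        intro H
        ext s
        by_cases hs : s = .inl q
        · subst hs
          simp [(hg (f q) List.mem_cons_self (.inl q)).2 ⟨q, rfl, rfl⟩]
        · have : g s ≠ .inl (f q) := by
            rw [Ne, hg _ List.mem_cons_self]
            rintro ⟨p, rfl, hp⟩
            rw [← hpf, h, Option.some_inj] at hp
            exact hs (congrArg _ hp.symm)
          simp [Function.update_of_ne this, Function.update_of_ne hs]
      rw [hu, hap]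
      simp only [hD, ih hap₀ hg', hu]

theorem monotone_nest [Preorder X] (hD : ∀ q, Monotone (D q))
    (hap₀ : ∀ q F G, Monotone F → F ≤ G → ap₀ q F ≤ ap₀ q G) {ap : Q → (X → X) → X}
    (hap : ∀ q F G, Monotone F → F ≤ G → ap q F ≤ ap q G) (l : List Q) :
    Monotone (nest D ap₀ ap l) := by
  induction l generalizing ap with
  | nil => exact monotone_id
  | cons q l ih =>
    have hu : ∀ {e e' : Q ⊕ Y → X} {H H' : X}, e ≤ e' → H ≤ H' →
        Function.update e (.inl q) H ≤ Function.update e' (.inl q) H' := by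
      intro e e' H H' he hH
      exact update_le_update_iff.2 ⟨hH, fun s _ => he s⟩
    intro e e' he
    rw [nest, nest]
    exact ih hap (hu he (hap q _ _ (fun H H' hH => hD q (ih hap₀ (hu le_rfl hH)))
      fun H => hD q (ih hap₀ (hu he le_rfl))))

end Nest


/-! ### Winning countdown games -/

section Game

variable {V : Type u} {R : Type v} [LinearOrder R] [Finite R]

theorem Game.FinPlay.of_append {G : Game.{u, v, w} V R} {P : Player} {σ : G.Strategy}
    {γ d : Config V G.nonstd} {π : List (Config V G.nonstd)} (h : G.FinPlay P σ γ (π ++ [d]))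
    (hπ : π ≠ []) : ∃ π' c, π = π' ++ [c] ∧ G.FinPlay P σ γ π ∧ G.Step c d ∧
      (G.mover c = P → σ π = some d) := by
  generalize hπ' : π ++ [d] = π' at h
  cases h with
  | init =>
    rw [List.append_eq_singleton_iff] at hπ'
    simp [hπ] at hπ'
  | step π₀ c d' h hcd hσ =>
    obtain ⟨rfl, h'⟩ := List.append_inj' hπ' rfl
    obtain rfl : d = d' := by simpa using h'
    exact ⟨π₀, c, rfl, h, hcd, hσ⟩

theorem Game.finPlay_range {G : Game.{u, v, w} V R} {P : Player} {σ : G.Strategy}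
    {γ : Config V G.nonstd} {ρ : ℕ → Config V G.nonstd}
    (h : ∀ n, G.FinPlay P σ γ ((List.range (n + 1)).map ρ)) (n : ℕ) :
    G.Step (ρ n) (ρ (n + 1)) ∧
      (G.mover (ρ n) = P → σ ((List.range (n + 1)).map ρ) = some (ρ (n + 1))) := by
  have h' := h (n + 1)
  rw [List.range_succ, List.map_append] at h'
  obtain ⟨π, c, hπ, -, h₁, h₂⟩ := h'.of_append (by simp)
  rw [List.range_succ, List.map_append] at hπ
  obtain rfl : ρ n = c := by
    have := (List.append_inj' hπ rfl).2
    simpa using this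
  exact ⟨h₁, h₂⟩

/-- No configuration is won by both players. -/
theorem Game.not_wins_of_wins {G : Game.{u, v, w} V R} {γ : Config V G.nonstd}
    (he : G.Wins .eve γ) (ha : G.Wins .adam γ) : False := by
  obtain ⟨σ, hσ, hσ'⟩ := he
  obtain ⟨τ, hτ, hτ'⟩ := ha
  have key : ∀ π c, G.FinPlay .eve σ γ (π ++ [c]) ∧ G.FinPlay .adam τ γ (π ++ [c]) →
      ∃ d, G.FinPlay .eve σ γ (π ++ [c] ++ [d]) ∧ G.FinPlay .adam τ γ (π ++ [c] ++ [d]) := by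
    rintro π c ⟨h₁, h₂⟩
    cases hc : G.mover c with
    | eve =>
      obtain ⟨d, hd, hcd⟩ := hσ π c h₁ hc
      exact ⟨d, .step _ _ _ h₁ hcd fun _ => hd, .step _ _ _ h₂ hcd fun h => by simp [hc] at h⟩
    | adam =>
      obtain ⟨d, hd, hcd⟩ := hτ π c h₂ hc
      exact ⟨d, .step _ _ _ h₁ hcd fun h => by simp [hc] at h, .step _ _ _ h₂ hcd fun _ => hd⟩
  choose! next hnext using key
  -- The two strategies are played against each other; the pair stores the history and the current
  -- configuration.
  let L : ℕ → List (Config V G.nonstd) × Config V G.nonstd :=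
    fun n => n.rec ([], γ) fun _ p => (p.1 ++ [p.2], next p.1 p.2)
  have hL : ∀ n, G.FinPlay .eve σ γ ((L n).1 ++ [(L n).2]) ∧
      G.FinPlay .adam τ γ ((L n).1 ++ [(L n).2]) := by
    intro n
    induction n with
    | zero => exact ⟨.init, .init⟩
    | succ n ih => exact hnext _ _ ih
  have hr : ∀ n, (L n).1 ++ [(L n).2] = (List.range (n + 1)).map fun k => (L k).2 := by
    intro n
    induction n with
    | zero => rfl
    | succ n ih =>
      rw [List.range_succ, List.map_append, ← ih]
      rfl
  obtain ⟨r, hr₁, hr₂⟩ := hσ' (fun k => (L k).2) fun n => by rw [← hr]; exact (hL n).1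
  obtain ⟨r', hr₁', hr₂'⟩ := hτ' (fun k => (L k).2) fun n => by rw [← hr]; exact (hL n).2
  obtain rfl := hr₁.unique hr₁'
  cases h : G.rankOwner r <;> simp [h] at hr₂ hr₂'

theorem Game.exists_isGreatest_infOften (G : Game.{u, v, w} V R)
    (ρ : ℕ → Config V G.nonstd) : ∃ r, IsGreatest {r' | G.InfOften ρ r'} r := by
  have hne : {r' | G.InfOften ρ r'}.Nonempty := by
    by_contra h
    rw [Set.not_nonempty_iff_eq_empty, Set.eq_empty_iff_forall_notMem] at h
    have h' : ∀ r, ∀ᶠ n in Filter.atTop, G.rank (ρ n).pos ≠ r :=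
      fun r => Filter.not_frequently.1 (h r)
    obtain ⟨n, hn⟩ := (Filter.eventually_all.2 h').exists
    exact hn _ rfl
  obtain ⟨r, hr, hr'⟩ := Set.exists_max_image _ id (Set.toFinite {r' | G.InfOften ρ r'}) hne
  exact ⟨r, hr, hr'⟩

theorem Game.InfOften.eventually_le {G : Game.{u, v, w} V R} {ρ : ℕ → Config V G.nonstd} {r : R}
    (h : IsGreatest {r' | G.InfOften ρ r'} r) :
    ∀ᶠ n in Filter.atTop, G.rank (ρ n).pos ≤ r := by
  have h' : ∀ r', r < r' → ∀ᶠ n in Filter.atTop, G.rank (ρ n).pos ≠ r' :=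
    fun r' hr => Filter.not_frequently.1 fun hf => (h.2 hf).not_gt hr
  have : ∀ᶠ n in Filter.atTop, ∀ r', r < r' → G.rank (ρ n).pos ≠ r' := by
    refine Filter.eventually_all.2 fun r' => ?_
    by_cases hr : r < r'
    · filter_upwards [h' r' hr] with n hn _ using hn
    · exact Filter.Eventually.of_forall fun n h => absurd h hr
  filter_upwards [this] with n hn
  exact not_lt.1 fun hlt => hn _ hlt rfl

/-- A signature assigns a measure to each rank of player `P`. It may not increase in a move, except
at ranks below the one that is counted down, and has to decrease at the latter. -/
def Game.Progress (G : Game.{u, v, w} V R) (P : Player) {ι : Type*} [LinearOrder ι] :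
    Config V G.nonstd → (R → ι) → (R → ι) → Prop
  | .positional _ _, f, f' => ∀ r, G.rankOwner r = P → f' r ≤ f r
  | .countdown v _, f, f' => ∀ r, G.rankOwner r = P →
      (G.rank v < r → f' r ≤ f r) ∧ (G.rank v = r → f' r < f r)

/-- If the dominating rank `r` belonged to `P`, then from some point on no higher rank would occur,
so the measure at `r` would never increase and would drop at infinitely many countdowns,
contradicting well-foundedness. -/
theorem Game.winsInf_of_progress {G : Game.{u, v, w} V R} {P : Player} {ι : Type*} [LinearOrder ι]
    [WellFoundedLT ι] {ρ : ℕ → Config V G.nonstd} {f : ℕ → R → ι}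
    (hstep : ∀ n, G.Step (ρ n) (ρ (n + 1)))
    (hf : ∀ n, G.Progress P (ρ n) (f n) (f (n + 1))) : G.WinsInf P ρ := by
  obtain ⟨r, hr⟩ := G.exists_isGreatest_infOften ρ
  refine ⟨r, hr, fun hP => ?_⟩
  obtain ⟨N, hN⟩ := Filter.eventually_atTop.1 (Game.InfOften.eventually_le hr)
  have hle : ∀ n ≥ N, f (n + 1) r ≤ f n r ∧
      ((∃ v c, ρ n = .countdown v c ∧ G.rank v = r) → f (n + 1) r < f n r) := by
    intro n hn
    have h₁ := hf n
    have h₂ := hN n hn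
    cases hc : ρ n with
    | positional v c =>
      rw [hc] at h₁
      exact ⟨h₁ r hP, by rintro ⟨_, _, h, -⟩; cases h⟩
    | countdown v c =>
      rw [hc] at h₁ h₂
      rcases (show G.rank v ≤ r from h₂).lt_or_eq with h | h
      · refine ⟨(h₁ r hP).1 h, ?_⟩
        rintro ⟨_, _, h', h''⟩
        cases h'
        exact absurd h'' h.ne
      · exact ⟨((h₁ r hP).2 h).le, fun _ => (h₁ r hP).2 h⟩
  have hanti : ∀ n k, N ≤ n → f (n + k) r ≤ f n r := by
    intro n k hn
    induction k with
    | zero => exact le_rfl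
    | succ k ih => exact ((hle (n + k) (by omega)).1).trans ih
  obtain ⟨_, ⟨n₀, hn₀, rfl⟩, hmin⟩ :=
    WellFounded.has_min (wellFounded_lt (α := ι)) ((fun n => f n r) '' Set.Ici N)
      ⟨_, N, Set.mem_Ici.2 le_rfl, rfl⟩
  rw [Set.mem_Ici] at hn₀
  -- The occurrence of `r` may be a positional configuration; its predecessor is then the countdown
  -- at the same position. Searching from `n₀ + 1` keeps that predecessor at or after `n₀`.
  obtain ⟨n, hn, hnr⟩ := (Filter.frequently_atTop.1 (show G.InfOften ρ r from hr.1)) (n₀ + 1)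
  have : ∃ n ≥ n₀, ∃ v c, ρ n = .countdown v c ∧ G.rank v = r := by
    cases hc : ρ n with
    | countdown v c => exact ⟨n, by omega, v, c, hc, by rwa [hc] at hnr⟩
    | positional v c =>
      obtain ⟨k, rfl⟩ : ∃ k, n = k + 1 := ⟨n - 1, by omega⟩
      have hs := hstep k
      rw [hc] at hs hnr
      generalize hk : ρ k = ck at hs
      cases hs
      exact ⟨k, by omega, v, _, hk, hnr⟩
  obtain ⟨k, hk, hc⟩ := this
  have h₁ := (hle k (by omega)).2 hc
  obtain ⟨j, rfl⟩ := Nat.exists_eq_add_of_le hk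
  exact hmin _ ⟨n₀ + j + 1, Set.mem_Ici.2 (by omega), rfl⟩ (h₁.trans_le (hanti n₀ j hn₀))

/-- A player wins if she can maintain an invariant that comes with a signature. -/
theorem Game.wins_of_invariant (G : Game.{u, v, w} V R) (P : Player) {S ι : Type*} [LinearOrder ι]
    [WellFoundedLT ι] (I : Config V G.nonstd → S → Prop) (sig : Config V G.nonstd → S → R → ι)
    (hP : ∀ c s, I c s → G.mover c = P →
      ∃ d, G.Step c d ∧ ∃ s', I d s' ∧ G.Progress P c (sig c s) (sig d s'))
    (hO : ∀ c s, I c s → G.mover c ≠ P → ∀ d, G.Step c d →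
      ∃ s', I d s' ∧ G.Progress P c (sig c s) (sig d s'))
    {γ : Config V G.nonstd} {s₀ : S} (h₀ : I γ s₀) : G.Wins P γ := by
  classical
  let T (c : Config V G.nonstd) (s : S) (d : Config V G.nonstd) (s' : S) : Prop :=
    I d s' ∧ G.Progress P c (sig c s) (sig d s')
  -- A strategy sees only the play, so the auxiliary state of the invariant is recomputed by folding
  -- over the play with a fixed choice of successor states.
  let upd (p : Config V G.nonstd × S) (d : Config V G.nonstd) : Config V G.nonstd × S :=
    (d, if h : ∃ s', T p.1 p.2 d s' then h.choose else p.2)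
  let st (π : List (Config V G.nonstd)) : Config V G.nonstd × S := π.tail.foldl upd (γ, s₀)
  let σ : G.Strategy := fun π =>
    if h : ∃ d, G.Step (st π).1 d ∧ ∃ s', T (st π).1 (st π).2 d s' then some h.choose else none
  have hst : ∀ {π d}, π ≠ [] → st (π ++ [d]) = upd (st π) d := by
    intro π d hπ
    simp only [st, List.tail_append_of_ne_nil hπ, List.foldl_append, List.foldl_cons,
      List.foldl_nil]
  have hupd : ∀ {p d}, (∃ s', T p.1 p.2 d s') → T p.1 p.2 d (upd p d).2 := by
    intro p d h
    simp only [upd, dif_pos h]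
    exact h.choose_spec
  have hσ : ∀ {π}, I (st π).1 (st π).2 → G.mover (st π).1 = P →
      ∃ d, σ π = some d ∧ G.Step (st π).1 d ∧ ∃ s', T (st π).1 (st π).2 d s' := by
    intro π hI hm
    have h : ∃ d, G.Step (st π).1 d ∧ ∃ s', T (st π).1 (st π).2 d s' := hP _ _ hI hm
    exact ⟨h.choose, by simp only [σ, dif_pos h], h.choose_spec⟩
  have hT : ∀ {π d}, I (st π).1 (st π).2 → G.Step (st π).1 d →
      (G.mover (st π).1 = P → σ π = some d) → T (st π).1 (st π).2 d (upd (st π) d).2 := by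
    intro π d hI hs hd
    apply hupd
    by_cases hm : G.mover (st π).1 = P
    · obtain ⟨d', h₁, h₂⟩ := hσ hI hm
      obtain rfl : d = d' := by simpa [h₁] using (hd hm).symm
      exact h₂.2
    · exact hO _ _ hI hm d hs
  have hplay : ∀ {π}, G.FinPlay P σ γ π →
      π.getLast? = some (st π).1 ∧ I (st π).1 (st π).2 := by
    intro π h
    induction h with
    | init => exact ⟨rfl, h₀⟩
    | step π c d h hcd hd ih =>
      rw [List.getLast?_concat, Option.some_inj] at ih
      rw [hst (by simp)]
      refine ⟨by simp [upd], ?_⟩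
      rw [ih.1] at hcd hd
      exact (hT ih.2 (ih.1 ▸ hcd) (ih.1 ▸ hd)).1
  refine ⟨σ, fun π c h hm => ?_, fun ρ h => ?_⟩
  · obtain ⟨h₁, h₂⟩ := hplay h
    rw [List.getLast?_concat, Option.some_inj] at h₁
    obtain ⟨d, hd, hs, -⟩ := hσ h₂ (h₁ ▸ hm)
    exact ⟨d, hd, h₁ ▸ hs⟩
  · have hρ : ∀ n, ρ n = (st ((List.range (n + 1)).map ρ)).1 := by
      intro n
      have := (hplay (h n)).1
      rw [List.range_succ, List.map_append, List.map_singleton, List.getLast?_concat,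
        Option.some_inj] at this
      rw [List.range_succ, List.map_append, List.map_singleton]
      exact this
    refine Game.winsInf_of_progress
      (f := fun n => sig (ρ n) (st ((List.range (n + 1)).map ρ)).2)
      (fun n => (G.finPlay_range h n).1) fun n => ?_
    obtain ⟨h₁, h₂⟩ := G.finPlay_range h n
    have hI := (hplay (h n)).2
    have := hρ n
    have h₃ := hT hI (d := ρ (n + 1)) (by rwa [← this]) (by rwa [← this])
    rw [List.range_succ (n := n + 1), List.map_append, List.map_singleton, hst (by simp)]
    rw [← this] at h₃
    exact h₃.2

end Game


/-! ### The language of an automaton as a nested fixpoint -/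

section Step

variable {Act : Type v} (K : Model.{v, z} Act) {Z : Type u}

/-- The successors of a point under a transition. -/
def Moves (d : Finset Z ⊕ (Act × Z)) (m n : K.Point) (s : Z) : Prop :=
  match d with
  | .inl S => n = m ∧ s ∈ S
  | .inr (τ, p) => K.trans τ m n ∧ s = p

/-- The points from which ∃ve can ensure that one transition, chosen by player `P`, leads into the
given sets. -/
def evalStep (P : Player) (d : Finset Z ⊕ (Act × Z)) (e : Z → Set K.Point) : Set K.Point :=
  match P with
  | .eve => {m | ∃ n s, Moves K d m n s ∧ n ∈ e s}
  | .adam => {m | ∀ n s, Moves K d m n s → n ∈ e s}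

/-- The targets of a transition. -/
def targets (d : Finset Z ⊕ (Act × Z)) : Set Z :=
  match d with
  | .inl S => S
  | .inr (_, p) => {p}

variable {K}

theorem Moves.mem_targets {d : Finset Z ⊕ (Act × Z)} {m n : K.Point} {s : Z}
    (h : Moves K d m n s) : s ∈ targets d := by
  rcases d with S | ⟨τ, p⟩
  · exact h.2
  · exact h.2

theorem evalStep_congr {P : Player} {d : Finset Z ⊕ (Act × Z)} {e e' : Z → Set K.Point}
    (h : Set.EqOn e e' (targets d)) : evalStep K P d e = evalStep K P d e' := by
  cases P with
  | eve =>
    ext m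
    exact exists₂_congr fun n s => and_congr_right fun hm => by rw [h hm.mem_targets]
  | adam =>
    ext m
    exact forall₂_congr fun n s => imp_congr_right fun hm => by rw [h hm.mem_targets]

theorem monotone_evalStep (P : Player) (d : Finset Z ⊕ (Act × Z)) :
    Monotone (evalStep K P d) := by
  intro e e' h m hm
  cases P with
  | eve =>
    obtain ⟨n, s, h₁, h₂⟩ := hm
    exact ⟨n, s, h₁, h s h₂⟩
  | adam => exact fun n s h₁ => h s (hm n s h₁)

theorem Player.Claims.exists_moves {P : Player} {d : Finset Z ⊕ (Act × Z)} {e : Z → Set K.Point}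
    {m : K.Point} (h : P.Claims (m ∈ evalStep K P d e)) :
    ∃ n s, Moves K d m n s ∧ P.Claims (n ∈ e s) := by
  cases P with
  | eve => exact h
  | adam =>
    have h : ¬ ∀ n s, Moves K d m n s → n ∈ e s := h
    push Not at h
    exact h

theorem Player.Claims.of_moves {P P' : Player} {d : Finset Z ⊕ (Act × Z)} {e : Z → Set K.Point}
    {m n : K.Point} {s : Z} (h : P.Claims (m ∈ evalStep K P' d e)) (hP : P' ≠ P)
    (hm : Moves K d m n s) : P.Claims (n ∈ e s) := by
  cases P <;> cases P' <;> first | exact absurd rfl hP | skip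
  · exact h n s hm
  · exact fun hn => h ⟨n, s, hm, hn⟩

theorem evalStep_map {Z' : Type*} [DecidableEq Z'] (P : Player) (d : Finset Z ⊕ (Act × Z))
    (g : Z → Z') (e : Z' → Set K.Point) :
    evalStep K P (d.map (Finset.image g) (Prod.map id g)) e = evalStep K P d (e ∘ g) := by
  have key : ∀ m n s', Moves K (d.map (Finset.image g) (Prod.map id g)) m n s' ↔
      ∃ s, g s = s' ∧ Moves K d m n s := by
    intro m n s'
    rcases d with S | ⟨τ, p⟩
    · simp only [Sum.map_inl, Moves, Finset.mem_image]
      tauto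
    · simp only [Sum.map_inr, Prod.map, Moves, id]
      constructor
      · rintro ⟨h, rfl⟩; exact ⟨p, rfl, h, rfl⟩
      · rintro ⟨s, rfl, h, rfl⟩; exact ⟨h, rfl⟩
  cases P with
  | eve =>
    ext m
    constructor
    · rintro ⟨n, s', h, hn⟩
      obtain ⟨s, rfl, h'⟩ := (key _ _ _).1 h
      exact ⟨n, s, h', hn⟩
    · rintro ⟨n, s, h, hn⟩
      exact ⟨n, g s, (key _ _ _).2 ⟨s, rfl, h⟩, hn⟩
  | adam =>
    ext m
    constructor
    · intro hm n s h
      exact hm n (g s) ((key _ _ _).2 ⟨s, rfl, h⟩)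
    · intro hm n s' h
      obtain ⟨s, rfl, h'⟩ := (key _ _ _).1 h
      exact hm n s h'

theorem mem_evalStep_eve_inl {T : Finset Z}
    {e : Z → Set K.Point} {m : K.Point} :
    m ∈ evalStep K .eve (.inl T) e ↔ ∃ s ∈ T, m ∈ e s := by
  simp [evalStep, Moves]

theorem mem_evalStep_adam_inl {T : Finset Z}
    {e : Z → Set K.Point} {m : K.Point} :
    m ∈ evalStep K .adam (.inl T) e ↔ ∀ s ∈ T, m ∈ e s :=
  ⟨fun h s hs => h m s ⟨rfl, hs⟩, fun h _ s hs => hs.1 ▸ h s hs.2⟩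

theorem evalStep_singleton {s : Z} (P : Player)
    {e : Z → Set K.Point} : evalStep K P (.inl {s}) e = e s := by
  ext m
  cases P
  · simp [mem_evalStep_eve_inl]
  · simp [mem_evalStep_adam_inl]

end Step

section Automaton

variable {Var : Type u} {Act : Type v}

theorem Automaton.edge_inl_iff (A : Automaton.{u, v, w} Var Act) (K : Model.{v, z} Act)
    {m n : K.Point} {q : A.Q} {s : A.Q ⊕ Var} :
    A.edge K (m, .inl q) (n, s) ↔ Moves K (A.δ q) m n s := by
  simp only [Automaton.edge, Moves]
  rcases A.δ q with S | ⟨τ, p⟩ <;> rfl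

open Classical in
/-- The initial bound of the fixpoint that belongs to a state. -/
noncomputable def Automaton.bound (A : Automaton.{u, v, w} Var Act) (q : A.Q) :
    WithTop Ordinal.{w} :=
  if h : A.rank q ∈ A.nonstd then A.ctrI ⟨A.rank q, h⟩ else ⊤

/-- The approximation operators for the states under given bounds. -/
noncomputable def Automaton.ap (A : Automaton.{u, v, w} Var Act) {X : Type z}
    (c : A.Q → WithTop Ordinal.{y}) (q : A.Q) (F : Set X → Set X) : Set X :=
  approx (A.rankOwner (A.rank q)) F (c q)

/-- The sets of points from which ∃ve wins when a state is entered with given counters. -/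
noncomputable def Automaton.solution (A : Automaton.{u, v, w} Var Act) (K : Model.{v, z} Act)
    (b c : A.Q → WithTop Ordinal.{y}) (l : List A.Q) (val : Var → Set K.Point) :
    A.Q ⊕ Var → Set K.Point :=
  nest (fun q => evalStep K (A.owner q) (A.δ q)) (A.ap b) (A.ap c) l
    (Sum.elim (fun _ => ∅) val)

theorem Automaton.monotone_ap (A : Automaton.{u, v, w} Var Act) {X : Type z}
    (c : A.Q → WithTop Ordinal.{y}) (q : A.Q) (F G : Set X → Set X) (hF : Monotone F)
    (h : F ≤ G) : A.ap c q F ≤ A.ap c q G :=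
  approx_mono hF h _ _

theorem Automaton.solution_inr (A : Automaton.{u, v, w} Var Act) {K : Model.{v, z} Act}
    {b c : A.Q → WithTop Ordinal.{y}} {l : List A.Q} {val : Var → Set K.Point} (x : Var) :
    A.solution K b c l val (.inr x) = val x := by
  rw [Automaton.solution, nest_of_notMem (by simp)]
  rfl

/-- The value of a state is an approximation of a fixpoint of a map that depends only on the
counters of the higher ranks, whenever the lower counters have been reset. -/
theorem Automaton.exists_solution_eq (A : Automaton.{u, v, w} Var Act) (K : Model.{v, z} Act)
    (b c : A.Q → WithTop Ordinal.{y}) {l : List A.Q}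
    (hl : l.Pairwise fun p q => A.rank q < A.rank p) (val : Var → Set K.Point) {q : A.Q}
    (hq : q ∈ l) :
    ∃ F : Set K.Point → Set K.Point, Monotone F ∧
      A.solution K b c l val (.inl q) = approx (A.rankOwner (A.rank q)) F (c q) ∧
      ∀ c', (∀ p, A.rank q < A.rank p → c' p = c p) → (∀ p, A.rank p < A.rank q → c' p = b p) →
        evalStep K (A.owner q) (A.δ q) (A.solution K b c' l val) =
          F (approx (A.rankOwner (A.rank q)) F (c' q)) := by
  classical
  obtain ⟨l₁, l₂, rfl⟩ := List.append_of_mem hq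
  rw [List.pairwise_append, List.pairwise_cons] at hl
  obtain ⟨-, ⟨h₂, -⟩, h₁⟩ := hl
  set D : A.Q → (A.Q ⊕ Var → Set K.Point) → Set K.Point :=
    fun q => evalStep K (A.owner q) (A.δ q)
  obtain ⟨e', he'⟩ := exists_nest_append (D := D) (ap₀ := A.ap b) (ap := A.ap c) l₁ (q :: l₂)
    (Sum.elim (fun _ => ∅) val)
  have hne : ∀ p ∈ l₂, (.inl q : A.Q ⊕ Var) ≠ .inl p := by
    rintro p hp h
    cases h
    exact lt_irrefl _ (h₂ q hp)
  -- The environment `e'` freezes the values of the higher states, which do not depend on the bounds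
  -- from `q` downwards, and `F` solves the lower states with reset bounds. A valuation `c'` as in
  -- the third claim therefore yields the same `e'` and the same inner system.
  refine ⟨fun H => D q (nest D (A.ap b) (A.ap b) l₂ (Function.update e' (.inl q) H)), ?_, ?_, ?_⟩
  · intro H H' hH
    exact monotone_evalStep _ _ (monotone_nest (fun q => monotone_evalStep _ _) (A.monotone_ap b)
      (A.monotone_ap b) l₂ (update_le_update_iff.2 ⟨hH, fun _ _ => le_rfl⟩))
  · rw [Automaton.solution, he' _ fun _ _ => rfl, nest, nest_of_notMem hne, Function.update_self]
    rfl
  · intro c' hc₁ hc₂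
    have hap₁ : ∀ p ∈ l₁, A.ap (X := K.Point) c' p = A.ap c p := fun p hp => by
      unfold Automaton.ap
      rw [hc₁ p (h₁ p hp q List.mem_cons_self)]
    have hap₂ : ∀ p ∈ l₂, A.ap (X := K.Point) c' p = A.ap b p := fun p hp => by
      unfold Automaton.ap
      rw [hc₂ p (h₂ p hp)]
    rw [Automaton.solution, he' _ hap₁, nest, nest_congr_ap hap₂]
    rfl

/-! ### Invariant and signature for the semantic game -/

section Link

variable {A : Automaton.{u, v, w} Var Act} {K : Model.{v, z} Act} {val : Var → Set K.Point}

/-- The initial bounds, in a universe that is large enough for all closure ordinals. -/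
noncomputable def Automaton.liftBound (A : Automaton.{u, v, w} Var Act) (q : A.Q) :
    WithTop Ordinal.{max w z} :=
  (A.bound q).map Ordinal.lift.{z}

/-- Bounds that agree with the counters of a configuration. -/
def Automaton.Link (A : Automaton.{u, v, w} Var Act) (K : Model.{v, z} Act)
    (val : Var → Set K.Point) (P : Player) (ctr : (A.game K val).nonstd → Ordinal.{w})
    (c : A.Q → WithTop Ordinal.{max w z}) : Prop :=
  ∀ q, (∀ h : A.rank q ∈ A.nonstd, c q = Ordinal.lift.{z} (ctr ⟨(A.rank q : WithBot A.R), h⟩)) ∧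
    (A.rank q ∉ A.nonstd → A.rankOwner (A.rank q) ≠ P → c q = ⊤)

theorem Automaton.link_liftBound (P : Player) :
    A.Link K val P (A.game K val).ctrI A.liftBound := by
  intro q
  constructor
  · intro h
    rw [Automaton.liftBound, Automaton.bound, dif_pos h]
    rfl
  · intro h _
    rw [Automaton.liftBound, Automaton.bound, dif_neg h]
    rfl

open Classical in
/-- The bounds after a countdown at the rank of a state. -/
noncomputable def Automaton.countBound (A : Automaton.{u, v, w} Var Act) (q : A.Q)
    (a : WithTop Ordinal.{max w z}) (c : A.Q → WithTop Ordinal.{max w z}) (p : A.Q) :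
    WithTop Ordinal.{max w z} :=
  if A.rank p < A.rank q then A.liftBound.{u, v, w, z} p else if A.rank p = A.rank q then a else c p

theorem Automaton.Link.count {P : Player} {ctr ctr' : (A.game K val).nonstd → Ordinal.{w}}
    {c : A.Q → WithTop Ordinal.{max w z}} (hc : A.Link K val P ctr c) {q : A.Q}
    (hinj : A.InjectivelyRanked)
    {a : WithTop Ordinal.{max w z}}
    (hlt : ∀ r, r.1 < (A.rank q : WithBot A.R) → ctr' r = (A.game K val).ctrI r)
    (hgt : ∀ r, (A.rank q : WithBot A.R) < r.1 → ctr' r = ctr r)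
    (ha : ∀ h : A.rank q ∈ A.nonstd,
      a = Ordinal.lift.{z} (ctr' ⟨(A.rank q : WithBot A.R), h⟩))
    (ha' : A.rank q ∉ A.nonstd → A.rankOwner (A.rank q) ≠ P → a = ⊤) :
    A.Link K val P ctr' (A.countBound q a c) := by
  intro p
  rcases lt_trichotomy (A.rank p) (A.rank q) with h | h | h
  · rw [Automaton.countBound, if_pos h]
    refine ⟨fun hp => ?_, (A.link_liftBound (val := val) P p).2⟩
    rw [hlt _ (WithBot.coe_lt_coe.2 h)]
    exact (A.link_liftBound (val := val) P p).1 hp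
  · obtain rfl := hinj h
    rw [Automaton.countBound, if_neg (lt_irrefl _), if_pos rfl]
    exact ⟨ha, ha'⟩
  · rw [Automaton.countBound, if_neg h.not_gt, if_neg h.ne']
    refine ⟨fun hp => ?_, (hc p).2⟩
    rw [hgt _ (WithBot.coe_lt_coe.2 h)]
    exact (hc p).1 hp

/-- The invariant that player `P` maintains. -/
def Automaton.Inv (A : Automaton.{u, v, w} Var Act) (K : Model.{v, z} Act)
    (val : Var → Set K.Point) (l : List A.Q) (P : Player) :
    Config (K.Point × (A.Q ⊕ Var)) (A.game K val).nonstd →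
      (A.Q → WithTop Ordinal.{max w z}) → Prop
  | .positional (m, .inl q) ctr, c => A.Link K val P ctr c ∧
      P.Claims (m ∈ evalStep K (A.owner q) (A.δ q) (A.solution K A.liftBound c l val))
  | .positional (m, .inr x) ctr, c => A.Link K val P ctr c ∧ P.Claims (m ∈ val x)
  | .countdown (m, s) ctr, c => A.Link K val P ctr c ∧
      P.Claims (m ∈ A.solution K A.liftBound c l val s)

open Classical in
/-- The signature for the invariant. -/
noncomputable def Automaton.sig (A : Automaton.{u, v, w} Var Act) (K : Model.{v, z} Act)
    (val : Var → Set K.Point) :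
    Config (K.Point × (A.Q ⊕ Var)) (A.game K val).nonstd → (A.Q → WithTop Ordinal.{max w z}) →
      WithBot A.R → WithTop Ordinal.{max w z}
  | _, c, some r => if h : ∃ q, A.rank q = r then c h.choose else 0
  -- The extra rank `⊥` belongs to ∃ve, so her measure has to drop in the countdown at a variable.
  -- One drop from 1 to 0 suffices because such positions are terminal.
  | .positional (_, .inr _) _, _, none => 0
  | _, _, none => 1

theorem Automaton.sig_rank (hinj : A.InjectivelyRanked) (γ) (c : A.Q → WithTop Ordinal.{max w z})
    (q : A.Q) : A.sig K val γ c (A.rank q : WithBot A.R) = c q := by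
  classical
  have h : ∃ p, A.rank p = A.rank q := ⟨q, rfl⟩
  have h' := hinj h.choose_spec
  have : A.sig K val γ c (A.rank q : WithBot A.R) =
      if h : ∃ p, A.rank p = A.rank q then c h.choose else 0 := by
    simp only [Automaton.sig]
  rw [this, dif_pos h, h']

theorem Automaton.sig_le {γ γ' : Config (K.Point × (A.Q ⊕ Var)) (A.game K val).nonstd}
    {c c' : A.Q → WithTop Ordinal.{max w z}} {r : A.R}
    (h : ∀ q, A.rank q = r → c' q = c q) :
    A.sig K val γ' c' (r : WithBot A.R) ≤ A.sig K val γ c (r : WithBot A.R) := by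
  simp only [Automaton.sig]
  split_ifs with h'
  · exact (h _ h'.choose_spec).le
  · exact le_rfl

/-- The common part of countdowns by either player: the higher bounds are untouched, the bound at
`q` becomes `a`, and the lower ones are reset, so the new value of the transition is the `F` of the
old configuration applied to its approximation at `a`. -/
theorem Automaton.inv_positional (hinj : A.InjectivelyRanked) {l : List A.Q} {P : Player}
    {m : K.Point} {q : A.Q} {ctr ctr' : (A.game K val).nonstd → Ordinal.{w}}
    {F : Set K.Point → Set K.Point} {c : A.Q → WithTop Ordinal.{max w z}}
    (hF : ∀ c', (∀ p, A.rank q < A.rank p → c' p = c p) →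
      (∀ p, A.rank p < A.rank q → c' p = A.liftBound p) →
        evalStep K (A.owner q) (A.δ q) (A.solution K A.liftBound c' l val) =
          F (approx (A.rankOwner (A.rank q)) F (c' q)))
    (hc : A.Link K val P ctr c) {a : WithTop Ordinal.{max w z}}
    (hlt : ∀ r, r.1 < (A.rank q : WithBot A.R) → ctr' r = (A.game K val).ctrI r)
    (hgt : ∀ r, (A.rank q : WithBot A.R) < r.1 → ctr' r = ctr r)
    (ha : ∀ h : A.rank q ∈ A.nonstd,
      a = Ordinal.lift.{z} (ctr' ⟨(A.rank q : WithBot A.R), h⟩))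
    (ha' : A.rank q ∉ A.nonstd → A.rankOwner (A.rank q) ≠ P → a = ⊤)
    (hm : P.Claims (m ∈ F (approx (A.rankOwner (A.rank q)) F a)))
    (hac : A.rankOwner (A.rank q) = P → a < c q) :
    A.Inv K val l P (.positional (m, .inl q) ctr') (A.countBound q a c) ∧
      (A.game K val).Progress P (.countdown (m, .inl q) ctr)
        (A.sig K val (.countdown (m, .inl q) ctr) c)
        (A.sig K val (.positional (m, .inl q) ctr') (A.countBound q a c)) := by
  have hq : A.countBound q a c q = a := by
    rw [Automaton.countBound, if_neg (lt_irrefl _), if_pos rfl]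
  refine ⟨⟨hc.count hinj hlt hgt ha ha', ?_⟩, fun r hr => ⟨fun hqr => ?_, fun hqr => ?_⟩⟩
  · rw [hF _ (fun p hp => ?_) (fun p hp => ?_), hq]
    · exact hm
    · rw [Automaton.countBound, if_neg hp.not_gt, if_neg hp.ne']
    · rw [Automaton.countBound, if_pos hp]
  · change (A.rank q : WithBot A.R) < r at hqr
    induction r with
    | bot => exact absurd hqr not_lt_bot
    | coe r =>
      refine Automaton.sig_le fun p hp => ?_
      subst hp
      rw [WithBot.coe_lt_coe] at hqr
      rw [Automaton.countBound, if_neg hqr.not_gt, if_neg hqr.ne']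
  · change (A.rank q : WithBot A.R) = r at hqr
    subst hqr
    rw [Automaton.sig_rank hinj, Automaton.sig_rank hinj, hq]
    exact hac hr

/-- At her own positions the truth of the claim supplies a move, and at her own ranks unfolding the
approximation supplies a smaller bound. Opposing moves preserve the claim. At a variable, the claim
means that the opponent owns the position and is stuck. -/
theorem Automaton.wins_of_inv (hinj : A.InjectivelyRanked) {l : List A.Q}
    (hl : l.Pairwise fun p q => A.rank q < A.rank p) (hl' : ∀ q, q ∈ l) {P : Player} {γ}
    {c : A.Q → WithTop Ordinal.{max w z}} (h : A.Inv K val l P γ c) :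
    (A.game K val).Wins P γ := by
  classical
  refine Game.wins_of_invariant _ P (A.Inv K val l P) (A.sig K val) ?_ ?_ h
  · rintro (⟨⟨m, q | x⟩, ctr⟩ | ⟨⟨m, q | x⟩, ctr⟩) c hI hm
    · obtain ⟨hc, hI⟩ := hI
      rw [show A.owner q = P from hm] at hI
      obtain ⟨n, s, hns, hn⟩ := hI.exists_moves
      refine ⟨.countdown (n, s) ctr, .move _ _ _ (A.edge_inl_iff K |>.2 hns), c, ⟨hc, hn⟩,
        fun r hr => ?_⟩
      induction r with
      | bot => exact le_rfl
      | coe r => exact Automaton.sig_le fun _ _ => rfl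
    · exfalso
      have hI := hI.2
      have hm : A.posOwner K val (m, .inr x) = P := hm
      by_cases hx : m ∈ val x <;> cases P <;> simp_all [Automaton.posOwner, Player.Claims]
    · obtain ⟨hc, hI⟩ := hI
      have hm : A.rankOwner (A.rank q) = P := hm
      obtain ⟨F, hF, hF₁, hF₂⟩ := A.exists_solution_eq K A.liftBound c hl val (hl' q)
      rw [hF₁, hm] at hI
      obtain ⟨a, ha, hI⟩ := claims_approx_self.{w} hF hI
      -- For a nonstandard rank, `a` lies below a lifted counter and so comes from an ordinal of the
      -- game. For a standard rank it is fictitious, and 0 is a dummy.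
      obtain ⟨α, hα⟩ : ∃ α : Ordinal.{w}, ∀ h : A.rank q ∈ A.nonstd,
          a = Ordinal.lift.{z} α ∧ α < ctr ⟨(A.rank q : WithBot A.R), h⟩ := by
        by_cases hq : A.rank q ∈ A.nonstd
        · rw [(hc q).1 hq] at ha
          obtain ⟨b, rfl, hb⟩ := WithTop.lt_iff_exists_coe.1 ha
          rw [WithTop.coe_lt_coe] at ha
          obtain ⟨α, rfl⟩ := Ordinal.mem_range_lift_of_le ha.le
          exact ⟨α, fun _ => ⟨rfl, Ordinal.lift_lt.1 ha⟩⟩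
        · exact ⟨0, fun h => absurd h hq⟩
      let ctr' : (A.game K val).nonstd → Ordinal.{w} := fun r =>
        if r.1 < (A.rank q : WithBot A.R) then (A.game K val).ctrI r
        else if r.1 = (A.rank q : WithBot A.R) then α else ctr r
      have hlt : ∀ r, r.1 < (A.rank q : WithBot A.R) → ctr' r = (A.game K val).ctrI r :=
        fun r hr => if_pos hr
      have heq : ∀ r, r.1 = (A.rank q : WithBot A.R) → ctr' r = α := fun r hr => by
        simp only [ctr', if_neg hr.not_lt, if_pos hr]
      have hgt : ∀ r, (A.rank q : WithBot A.R) < r.1 → ctr' r = ctr r := fun r hr => by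
        simp only [ctr', if_neg hr.not_gt, if_neg hr.ne']
      refine ⟨.positional (m, .inl q) ctr', .count _ _ _ hlt ?_ hgt, A.countBound q a c,
        Automaton.inv_positional hinj hF₂ hc hlt hgt ?_ ?_ ?_ fun _ => ha⟩
      · rintro ⟨r, hr⟩ h
        rw [heq _ h]
        obtain rfl : r = (A.rank q : WithBot A.R) := h
        exact (hα hr).2
      · intro h
        rw [heq _ rfl]
        exact (hα h).1
      · exact fun _ h => absurd hm h
      · rwa [hm]
    · obtain ⟨hc, hI⟩ := hI
      rw [Automaton.solution_inr] at hI
      refine ⟨.positional (m, .inr x) ctr, .count _ _ _ (fun r hr => absurd hr not_lt_bot) ?_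
        fun _ _ => rfl, c, ⟨hc, hI⟩, fun r hr => ⟨fun h => ?_, fun h => ?_⟩⟩
      · rintro ⟨r, hr⟩ rfl
        exact hr.elim
      · change ⊥ < r at h
        induction r with
        | bot => exact absurd h (lt_irrefl _)
        | coe r => exact Automaton.sig_le fun _ _ => rfl
      · obtain rfl : ⊥ = r := h
        exact zero_lt_one
  · rintro (⟨⟨m, q | x⟩, ctr⟩ | ⟨⟨m, q | x⟩, ctr⟩) c hI hm d hd
    · obtain ⟨hc, hI⟩ := hI
      cases hd with
      | move _ v' _ he =>
        obtain ⟨n, s⟩ := v'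
        refine ⟨c, ⟨hc, hI.of_moves hm (A.edge_inl_iff K |>.1 he)⟩, fun r hr => ?_⟩
        induction r with
        | bot => exact le_rfl
        | coe r => exact Automaton.sig_le fun _ _ => rfl
    · cases hd with
      | move _ v' _ he => exact he.elim
    · obtain ⟨hc, hI⟩ := hI
      have hm : A.rankOwner (A.rank q) ≠ P := hm
      obtain ⟨F, hF, hF₁, hF₂⟩ := A.exists_solution_eq K A.liftBound c hl val (hl' q)
      rw [hF₁] at hI
      cases hd with
      | count _ _ ctr' hlt heq hgt =>
        -- The new bound is dictated by the opponent's counter, or remains ∞ if the rank is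
        -- standard.
        let a : WithTop Ordinal.{max w z} := if h : A.rank q ∈ A.nonstd then
          (Ordinal.lift.{z} (ctr' ⟨(A.rank q : WithBot A.R), h⟩) : Ordinal.{max w z}) else ⊤
        refine ⟨A.countBound q a c, Automaton.inv_positional hinj hF₂ hc hlt hgt
          (fun h => dif_pos h) (fun h _ => dif_neg h) ?_ fun h => absurd h hm⟩
        refine claims_approx_other hF hm hI ?_
        by_cases h : A.rank q ∈ A.nonstd
        · left
          rw [(hc q).1 h]
          simp only [a, dif_pos h]
          exact WithTop.coe_lt_coe.2 (Ordinal.lift_lt.2 (heq _ rfl))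
        · exact .inr ⟨(hc q).2 h hm, dif_neg h⟩
    · obtain ⟨hc, hI⟩ := hI
      rw [Automaton.solution_inr] at hI
      cases hd with
      | count _ _ ctr' hlt heq hgt =>
        have : ctr' = ctr := by
          funext r
          refine hgt r (bot_lt_iff_ne_bot.2 ?_)
          rintro h
          obtain ⟨r, hr⟩ := r
          obtain rfl : r = ⊥ := h
          exact hr.elim
        subst this
        refine ⟨c, ⟨hc, hI⟩, fun r hr => ⟨fun h => ?_, fun h => ?_⟩⟩
        · change ⊥ < r at h
          induction r with
          | bot => exact absurd h (lt_irrefl _)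
          | coe r => exact Automaton.sig_le fun _ _ => rfl
        · obtain rfl : ⊥ = r := h
          exact zero_lt_one

/-- The language of an automaton is the solution of a nested system of fixpoint equations. -/
theorem Automaton.language_eq (hinj : A.InjectivelyRanked) {l : List A.Q}
    (hl : l.Pairwise fun p q => A.rank q < A.rank p) (hl' : ∀ q, q ∈ l) :
    A.language K val =
      evalStep K (A.owner A.qI) (A.δ A.qI) (A.solution K A.bound A.bound l val) := by
  have hs : A.solution K A.bound A.bound l val =
      A.solution K A.liftBound.{u, v, w, z} A.liftBound.{u, v, w, z} l val := by
    have : A.ap (X := K.Point) A.bound = A.ap (X := K.Point) A.liftBound.{u, v, w, z} := by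
      funext q F
      exact (approx_lift _ F (A.bound q)).symm
    rw [Automaton.solution, this]
    rfl
  rw [hs]
  ext m
  constructor
  · intro hm
    -- Outside the solution ∀dam's invariant holds initially, so he would win as well.
    by_contra h
    exact Game.not_wins_of_wins hm
      (Automaton.wins_of_inv hinj hl hl' (c := A.liftBound) ⟨A.link_liftBound _, h⟩)
  · intro hm
    exact Automaton.wins_of_inv hinj hl hl' (c := A.liftBound) ⟨A.link_liftBound _, hm⟩

end Link

end Automaton


/-! ### From automata to formulas -/

section ToFormula

open scoped Classical

variable {Var : Type u} {Act : Type v} {K : Model.{v, z} Act}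

/-- The fixpoint operator of a player. -/
def ScalarFormula.fix (P : Player) (a : WithTop Ordinal.{w}) (x : Var)
    (φ : ScalarFormula.{u, v, w} Var Act) : ScalarFormula.{u, v, w} Var Act :=
  match P with
  | .eve => .mu a x φ
  | .adam => .nu a x φ

theorem ScalarFormula.sem_fix (P : Player) (a : WithTop Ordinal.{w}) (x : Var)
    (φ : ScalarFormula.{u, v, w} Var Act) (val : Var → Set K.Point) :
    (ScalarFormula.fix P a x φ).sem K val =
      approx P (fun H => φ.sem K (Function.update val x H)) a := by
  cases P <;> rfl

/-- The formula for one transition. -/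
noncomputable def ScalarFormula.step {Z : Type y} (P : Player) (d : Finset Z ⊕ (Act × Z))
    (e : Z → ScalarFormula.{u, v, w} Var Act) : ScalarFormula.{u, v, w} Var Act :=
  match P, d with
  | .eve, .inl S => S.toList.foldr (fun s φ => .or (e s) φ) .bot
  | .adam, .inl S => S.toList.foldr (fun s φ => .and (e s) φ) .top
  | .eve, .inr (τ, p) => .dia τ (e p)
  | .adam, .inr (τ, p) => .box τ (e p)

theorem ScalarFormula.mem_sem_foldr_or {Z : Type y} {e : Z → ScalarFormula.{u, v, w} Var Act}
    {val : Var → Set K.Point} {m : K.Point} (l : List Z) :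
    m ∈ (l.foldr (fun s φ => .or (e s) φ) .bot : ScalarFormula Var Act).sem K val ↔
      ∃ s ∈ l, m ∈ (e s).sem K val := by
  induction l with
  | nil => simp [ScalarFormula.sem]
  | cons s l ih => simp [ScalarFormula.sem, ih]

theorem ScalarFormula.mem_sem_foldr_and {Z : Type y} {e : Z → ScalarFormula.{u, v, w} Var Act}
    {val : Var → Set K.Point} {m : K.Point} (l : List Z) :
    m ∈ (l.foldr (fun s φ => .and (e s) φ) .top : ScalarFormula Var Act).sem K val ↔
      ∀ s ∈ l, m ∈ (e s).sem K val := by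
  induction l with
  | nil => simp [ScalarFormula.sem]
  | cons s l ih => simp [ScalarFormula.sem, ih]

theorem ScalarFormula.sem_step {Z : Type y} (P : Player) (d : Finset Z ⊕ (Act × Z))
    (e : Z → ScalarFormula.{u, v, w} Var Act) (val : Var → Set K.Point) :
    (ScalarFormula.step P d e).sem K val = evalStep K P d fun s => (e s).sem K val := by
  ext m
  rcases d with S | ⟨τ, p⟩ <;> cases P
  · simp [ScalarFormula.step, ScalarFormula.mem_sem_foldr_or, mem_evalStep_eve_inl]
  · simp [ScalarFormula.step, ScalarFormula.mem_sem_foldr_and, mem_evalStep_adam_inl]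
  · simp [ScalarFormula.step, ScalarFormula.sem, evalStep, Moves]
  · simp [ScalarFormula.step, ScalarFormula.sem, evalStep, Moves]

/-- The formulas that solve the equations for the states in a list, with a variable for each
state. -/
noncomputable def Automaton.formula (A : Automaton.{u, v, w} Var Act) (x : A.Q → Var) :
    List A.Q → (A.Q ⊕ Var → ScalarFormula.{u, v, w} Var Act) →
      A.Q ⊕ Var → ScalarFormula.{u, v, w} Var Act
  | [], e => e
  | q :: l, e => A.formula x l (Function.update e (.inl q)
      (.fix (A.rankOwner (A.rank q)) (A.bound q) (x q) (.step (A.owner q) (A.δ q)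
        (A.formula x l (Function.update e (.inl q) (.var (x q)))))))

/-- Elimination of unknowns by substitution. Inside the scope of `q` its unknown is the variable `x
q`; afterwards it is the closed-off fixpoint formula. Hypothesis `he` is freshness in semantic form,
and it survives the substitution because the nested solution sees the valuation only through `e`. -/
theorem Automaton.sem_formula (A : Automaton.{u, v, w} Var Act) {x : A.Q → Var}
    (hx : Function.Injective x) {l : List A.Q} (hl : l.Nodup)
    {e : A.Q ⊕ Var → ScalarFormula.{u, v, w} Var Act}
    (he : ∀ s, ∀ q ∈ l, ∀ val H, (e s).sem K (Function.update val (x q) H) = (e s).sem K val)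
    (val : Var → Set K.Point) :
    (fun s => (A.formula x l e s).sem K val) =
      nest (fun q => evalStep K (A.owner q) (A.δ q)) (A.ap A.bound) (A.ap A.bound) l
        fun s => (e s).sem K val := by
  induction l generalizing e val with
  | nil => rfl
  | cons q l ih =>
    rw [List.nodup_cons] at hl
    have hxq : ∀ p ∈ l, x q ≠ x p := fun p hp h => hl.1 (hx h ▸ hp)
    have hu : ∀ (ψ : ScalarFormula.{u, v, w} Var Act) (val : Var → Set K.Point),
        (fun s => (Function.update e (.inl q) ψ s).sem K val) =
          Function.update (fun s => (e s).sem K val) (.inl q) (ψ.sem K val) := by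
      intro ψ val
      ext1 s
      by_cases hs : s = .inl q
      · subst hs; simp
      · simp [Function.update_of_ne hs]
    set θ : ScalarFormula.{u, v, w} Var Act := .fix (A.rankOwner (A.rank q)) (A.bound q) (x q)
      (.step (A.owner q) (A.δ q) (A.formula x l (Function.update e (.inl q) (.var (x q)))))
    have hθ : ∀ val : Var → Set K.Point, θ.sem K val = A.ap A.bound q fun H =>
        evalStep K (A.owner q) (A.δ q) (nest (fun q => evalStep K (A.owner q) (A.δ q))
          (A.ap A.bound) (A.ap A.bound) l
            (Function.update (fun s => (e s).sem K val) (.inl q) H)) := by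
      intro val
      rw [ScalarFormula.sem_fix, Automaton.ap]
      congr 1
      ext1 H
      rw [ScalarFormula.sem_step, ih hl.2, hu]
      · congr 3
        · ext1 s
          exact he s q List.mem_cons_self _ _
        · simp [ScalarFormula.sem]
      · intro s p hp val H
        by_cases hs : s = .inl q
        · subst hs
          simp [ScalarFormula.sem, Function.update_of_ne (hxq p hp)]
        · rw [Function.update_of_ne hs]
          exact he s p (List.mem_cons_of_mem _ hp) val H
    rw [Automaton.formula, nest, ih hl.2, hu, hθ]
    intro s p hp val H
    by_cases hs : s = .inl q
    · subst hs
      rw [Function.update_self, hθ, hθ]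
      simp only [he _ p (List.mem_cons_of_mem _ hp)]
    · rw [Function.update_of_ne hs]
      exact he s p (List.mem_cons_of_mem _ hp) val H

theorem Automaton.exists_sorted_list (A : Automaton.{u, v, w} Var Act)
    (hA : A.InjectivelyRanked) :
    ∃ l : List A.Q, l.Pairwise (fun p q => A.rank q < A.rank p) ∧ ∀ q, q ∈ l := by
  let _ : LinearOrder A.Q := LinearOrder.lift' A.rank hA
  have := Fintype.ofFinite A.Q
  refine ⟨(Finset.univ : Finset A.Q).sort.reverse, ?_, by simp⟩
  rw [List.pairwise_reverse]
  exact (Finset.univ : Finset A.Q).sortedLT_sort.pairwise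

theorem exists_injective_notMem {Q : Type y} [Finite Q] {Var : Type u} [Infinite Var]
    {S : Set Var} (hS : S.Finite) : ∃ x : Q → Var, Function.Injective x ∧ ∀ q, x q ∉ S := by
  have := hS.infinite_compl.to_subtype
  obtain ⟨n, ⟨f⟩⟩ := Finite.exists_equiv_fin Q
  let g := Infinite.natEmbedding (Sᶜ : Set Var)
  exact ⟨fun q => g (f q), fun p q h => f.injective (Fin.ext (g.injective (Subtype.ext h))),
    fun q => (g (f q)).2⟩

theorem finite_targets {Z : Type y} (d : Finset Z ⊕ (Act × Z)) : (targets d).Finite := by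
  rcases d with S | ⟨τ, p⟩
  · exact S.finite_toSet
  · exact Set.finite_singleton p

theorem Automaton.exists_formula [Infinite Var] (A : Automaton.{u, v, w} Var Act)
    (hA : A.InjectivelyRanked) :
    ∃ φ : ScalarFormula.{u, v, w} Var Act,
      ∀ (K : Model.{v, z} Act) (val : Var → Set K.Point), φ.sem K val = A.language K val := by
  obtain ⟨l, hl, hl'⟩ := A.exists_sorted_list hA
  let T : Set (A.Q ⊕ Var) := ⋃ q, targets (A.δ q)
  have hT : T.Finite := Set.finite_iUnion fun q => finite_targets (A.δ q)
  obtain ⟨x, hx, hxT⟩ := exists_injective_notMem (Q := A.Q)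
    (hT.preimage (Sum.inr_injective (α := A.Q) (β := Var)).injOn)
  -- Only variables in the finite set `T` of targets matter. Sending all others to `.bot` makes the
  -- chosen variables fresh for every value of `e`, and `nest_congr_env` removes the difference at
  -- the end.
  let e : A.Q ⊕ Var → ScalarFormula.{u, v, w} Var Act :=
    Sum.elim (fun _ => .bot) fun y => if .inr y ∈ T then .var y else .bot
  refine ⟨.step (A.owner A.qI) (A.δ A.qI) (A.formula x l e), fun K val => ?_⟩
  have he : ∀ s, ∀ q ∈ l, ∀ val H,
      (e s).sem K (Function.update val (x q) H) = (e s).sem K val := by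
    rintro (p | y) q - val H
    · rfl
    · by_cases hy : .inr y ∈ T
      · have : y ≠ x q := by
          rintro rfl
          exact hxT q hy
        simp [e, hy, ScalarFormula.sem, this]
      · simp [e, hy, ScalarFormula.sem]
  have hnd : l.Nodup := hl.imp fun h h' => h.ne (congrArg A.rank h'.symm)
  have hD : ∀ q (f f' : A.Q ⊕ Var → Set K.Point), Set.EqOn f f' T →
      evalStep K (A.owner q) (A.δ q) f = evalStep K (A.owner q) (A.δ q) f' :=
    fun q f f' h => evalStep_congr (h.mono (Set.subset_iUnion (fun q => targets (A.δ q)) q))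
  rw [Automaton.language_eq hA hl hl', ScalarFormula.sem_step, A.sem_formula hx hnd he]
  refine hD _ _ _ (nest_congr_env hD ?_)
  rintro (q | y) hs
  · rfl
  · simp [e, hs, ScalarFormula.sem]

end ToFormula


/-! ### From formulas to automata -/

section ToAutomaton

open scoped Classical

variable {Var : Type u} {Act : Type v} {Q : Type}

/-- An injectively ranked automaton with set of states `Q` and without initial state, whose states
are listed from the highest to the lowest rank. -/
structure System (Q : Type) (Var : Type u) (Act : Type v) where
  /-- The states, from the highest to the lowest rank. -/
  l : List Q
  nodup : l.Nodup
  mem_l : ∀ q, q ∈ l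
  /-- The owner of each state. -/
  owner : Q → Player
  /-- The owner of the rank of each state. -/
  fixOwner : Q → Player
  /-- The initial counter of a state, or `⊤` if its rank is standard. -/
  bound : Q → WithTop Ordinal.{w}
  /-- The transition function. -/
  δ : Q → Finset (Q ⊕ Var) ⊕ (Act × (Q ⊕ Var))

/-- The solution of the equations given by a system, where the values outside the system are given
by an environment. -/
noncomputable def System.solve (S : System.{u, v, w} Q Var Act) (K : Model.{v, z} Act)
    (l : List Q) (e : Q ⊕ Var → Set K.Point) : Q ⊕ Var → Set K.Point :=
  nest (fun q => evalStep K (S.owner q) (S.δ q)) (fun q F => approx (S.fixOwner q) F (S.bound q))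
    (fun q F => approx (S.fixOwner q) F (S.bound q)) l e

/-- The solution of the equations given by a system, under a valuation. -/
noncomputable def System.value (S : System.{u, v, w} Q Var Act) (K : Model.{v, z} Act)
    (val : Var → Set K.Point) : Q ⊕ Var → Set K.Point :=
  S.solve K S.l (Sum.elim (fun _ => ∅) val)

/-- The automaton given by a system and an initial state. -/
@[reducible]
noncomputable def System.toAutomaton (S : System.{u, v, w} Q Var Act) (qI : Q) :
    Automaton.{u, v, w} Var Act where
  Q := Q
  finiteQ := Finite.of_surjective S.l.get fun q => List.get_of_mem (S.mem_l q)
  -- The order is reversed because the list starts with the highest rank.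
  R := (Fin S.l.length)ᵒᵈ
  owner := S.owner
  qI := qI
  δ := S.δ
  rank q := OrderDual.toDual ⟨S.l.idxOf q, List.idxOf_lt_length_of_mem (S.mem_l q)⟩
  rankOwner r := S.fixOwner (S.l.get (OrderDual.ofDual r))
  nonstd := {r | S.bound (S.l.get (OrderDual.ofDual r)) ≠ ⊤}
  ctrI r := (S.bound (S.l.get (OrderDual.ofDual r.1))).untop r.2

variable {S : System.{u, v, w} Q Var Act}

theorem System.get_rank (qI q : Q) :
    S.l.get (OrderDual.ofDual ((S.toAutomaton qI).rank q)) = q :=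
  List.getElem_idxOf _

theorem System.injectivelyRanked_toAutomaton (qI : Q) :
    (S.toAutomaton qI).InjectivelyRanked := by
  intro p q h
  rw [← S.get_rank qI p, ← S.get_rank qI q, h]

theorem System.bound_toAutomaton (qI : Q) : (S.toAutomaton qI).bound = S.bound := by
  funext q
  unfold Automaton.bound
  split_ifs with h
  · change ((WithTop.untop _ h : Ordinal.{w}) : WithTop Ordinal.{w}) = _
    rw [WithTop.coe_untop]
    exact congrArg S.bound (S.get_rank qI q)
  · have h : ¬ S.bound (S.l.get (OrderDual.ofDual ((S.toAutomaton qI).rank q))) ≠ ⊤ := h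
    rw [S.get_rank, not_not] at h
    exact h.symm

theorem System.language_toAutomaton (qI : Q) (K : Model.{v, z} Act) (val : Var → Set K.Point) :
    (S.toAutomaton qI).language K val =
      evalStep K (S.owner qI) (S.δ qI) (S.value K val) := by
  have hl : S.l.Pairwise fun p q =>
      (S.toAutomaton qI).rank q < (S.toAutomaton qI).rank p := by
    rw [List.pairwise_iff_getElem]
    intro i j hi hj hij
    change (⟨S.l.idxOf S.l[i], _⟩ : Fin S.l.length) < ⟨S.l.idxOf S.l[j], _⟩
    rw [Fin.mk_lt_mk, S.nodup.idxOf_getElem, S.nodup.idxOf_getElem]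
    exact hij
  rw [Automaton.language_eq (S.injectivelyRanked_toAutomaton qI) hl S.mem_l, S.bound_toAutomaton]
  have hap : (S.toAutomaton qI).ap (X := K.Point) S.bound =
      fun q F => approx (S.fixOwner q) F (S.bound q) := by
    funext q F
    change approx (S.fixOwner (S.l.get (OrderDual.ofDual ((S.toAutomaton qI).rank q)))) F _ = _
    rw [S.get_rank]
  rw [Automaton.solution, hap]
  rfl

/-- The system without states. -/
def System.empty : System.{u, v, w} Empty Var Act where
  l := []
  nodup := List.nodup_nil
  mem_l q := q.elim
  owner := Empty.elim
  fixOwner := Empty.elim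
  bound := Empty.elim
  δ := Empty.elim

/-- The renaming of states and variables when the variables in a set are bound by a new state. -/
noncomputable def bindVars (ρ : Set Var) : Q ⊕ Var → Option Q ⊕ Var :=
  Sum.elim (fun q => .inl (some q)) fun y => if y ∈ ρ then .inl none else .inr y

/-- The extension of a system by a new state of the highest rank, which binds some variables. -/
noncomputable def System.extend (S : System.{u, v, w} Q Var Act) (ρ : Set Var) (P P' : Player)
    (a : WithTop Ordinal.{w}) (d : Finset (Q ⊕ Var) ⊕ (Act × (Q ⊕ Var))) :
    System.{u, v, w} (Option Q) Var Act where
  l := none :: S.l.map some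
  nodup := by simpa using S.nodup.map (Option.some_injective _)
  mem_l q := by cases q <;> simp [S.mem_l]
  owner q := q.elim P S.owner
  fixOwner q := q.elim P' S.fixOwner
  bound q := q.elim a S.bound
  δ q := (q.elim d S.δ).map (Finset.image (bindVars ρ)) (Prod.map id (bindVars ρ))

theorem System.solve_extend {ρ : Set Var} {P P' : Player} {a : WithTop Ordinal.{w}}
    {d : Finset (Q ⊕ Var) ⊕ (Act × (Q ⊕ Var))} (K : Model.{v, z} Act)
    (e : Option Q ⊕ Var → Set K.Point) :
    (S.extend ρ P P' a d).solve K (S.l.map some) e ∘ bindVars ρ =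
      S.solve K S.l (e ∘ bindVars ρ) := by
  have h := nest_simulation (X := Set K.Point)
    (D' := fun q => evalStep K ((S.extend ρ P P' a d).owner q) ((S.extend ρ P P' a d).δ q))
    (D := fun q => evalStep K (S.owner q) (S.δ q))
    (ap₀' := fun q F => approx ((S.extend ρ P P' a d).fixOwner q) F
      ((S.extend ρ P P' a d).bound q))
    (ap₀ := fun q F => approx (S.fixOwner q) F (S.bound q))
    (ap' := fun q F => approx ((S.extend ρ P P' a d).fixOwner q) F
      ((S.extend ρ P P' a d).bound q))
    (ap := fun q F => approx (S.fixOwner q) F (S.bound q)) (f := some) (g := bindVars ρ)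
    (pf := (id : Option Q → Option Q)) (fun q q' => eq_comm)
    (fun q e' => evalStep_map _ _ _ _) (fun q => rfl) (fun q => rfl) (l := S.l.map some) ?_ e
  · rw [List.filterMap_map] at h
    simpa [System.solve] using h
  · intro q' hq' s
    obtain ⟨p, -, rfl⟩ := List.mem_map.1 hq'
    rcases s with q | y
    · simp [bindVars]
    · by_cases hy : y ∈ ρ <;> simp [bindVars, hy]

theorem update_comp_bindVars {X : Type z} (ρ : Set Var) (val : Var → Set X) (H : Set X) :
    Function.update (Sum.elim (fun _ => ∅) val) (.inl none) H ∘ bindVars ρ =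
      (Sum.elim (fun _ => ∅) fun y => if y ∈ ρ then H else val y : Q ⊕ Var → Set X) := by
  ext1 s
  rcases s with q | y
  · exact Function.update_of_ne (by simp [bindVars]) _ _
  · by_cases hy : y ∈ ρ
    · simp only [Function.comp_apply, bindVars, Sum.elim_inr, if_pos hy, Function.update_self]
    · simp only [Function.comp_apply, bindVars, Sum.elim_inr, if_neg hy]
      exact Function.update_of_ne (by simp) _ _

/-- The new state is outermost, so while its fixpoint is computed the old system is solved with the
bound variables set to the current approximation, just as for a fixpoint formula. -/
theorem System.value_extend_none {ρ : Set Var} {P P' : Player} {a : WithTop Ordinal.{w}}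
    {d : Finset (Q ⊕ Var) ⊕ (Act × (Q ⊕ Var))} (K : Model.{v, z} Act)
    (val : Var → Set K.Point) :
    (S.extend ρ P P' a d).value K val (.inl none) =
      approx P' (fun H => evalStep K P d (S.value K fun y => if y ∈ ρ then H else val y)) a := by
  rw [System.value, System.solve, show (S.extend ρ P P' a d).l = none :: S.l.map some from rfl,
    nest_cons, nest_of_notMem (by simp), Function.update_self]
  change approx P' _ a = _
  congr 1
  ext1 H
  refine (evalStep_map P d (bindVars ρ) _).trans ?_
  rw [System.value, ← update_comp_bindVars]
  exact congrArg (evalStep K P d) (S.solve_extend K _)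

/-- Some state or variable of a system has the same meaning as the formula. -/
def ScalarFormula.HasSystem (φ : ScalarFormula.{u, v, w} Var Act) : Prop :=
  ∃ (Q : Type) (S : System.{u, v, w} Q Var Act) (s : Q ⊕ Var),
    ∀ (K : Model.{v, z} Act) (val : Var → Set K.Point), S.value K val s = φ.sem K val

/-- The disjoint union of two systems. -/
noncomputable def System.sum {Q₁ Q₂ : Type} (S₁ : System.{u, v, w} Q₁ Var Act)
    (S₂ : System.{u, v, w} Q₂ Var Act) :
    System.{u, v, w} (Q₁ ⊕ Q₂) Var Act where
  l := S₁.l.map .inl ++ S₂.l.map .inr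
  nodup := by
    rw [List.nodup_append]
    refine ⟨S₁.nodup.map Sum.inl_injective, S₂.nodup.map Sum.inr_injective, ?_⟩
    simp
  mem_l q := by cases q <;> simp [System.mem_l]
  owner := Sum.elim S₁.owner S₂.owner
  fixOwner := Sum.elim S₁.fixOwner S₂.fixOwner
  bound := Sum.elim S₁.bound S₂.bound
  δ := Sum.elim
    (fun q => (S₁.δ q).map (Finset.image (Sum.map .inl id)) (Prod.map id (Sum.map .inl id)))
    fun q => (S₂.δ q).map (Finset.image (Sum.map .inr id)) (Prod.map id (Sum.map .inr id))

theorem System.value_sum_left {Q₁ Q₂ : Type} (S₁ : System.{u, v, w} Q₁ Var Act)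
    (S₂ : System.{u, v, w} Q₂ Var Act) (K : Model.{v, z} Act)
    (val : Var → Set K.Point) (s : Q₁ ⊕ Var) :
    (S₁.sum S₂).value K val (Sum.map .inl id s) = S₁.value K val s := by
  have h := nest_simulation (X := Set K.Point)
    (D' := fun q => evalStep K ((S₁.sum S₂).owner q) ((S₁.sum S₂).δ q))
    (D := fun q => evalStep K (S₁.owner q) (S₁.δ q))
    (ap₀' := fun q F => approx ((S₁.sum S₂).fixOwner q) F ((S₁.sum S₂).bound q))
    (ap₀ := fun q F => approx (S₁.fixOwner q) F (S₁.bound q))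
    (ap' := fun q F => approx ((S₁.sum S₂).fixOwner q) F ((S₁.sum S₂).bound q))
    (ap := fun q F => approx (S₁.fixOwner q) F (S₁.bound q)) (f := Sum.inl)
    (g := (Sum.map .inl id : Q₁ ⊕ Var → (Q₁ ⊕ Q₂) ⊕ Var)) (pf := Sum.getLeft?)
    (fun q q' => by rw [Sum.getLeft?_eq_some_iff, eq_comm])
    (fun q e' => evalStep_map _ _ _ _) (fun q => rfl) (fun q => rfl) (l := (S₁.sum S₂).l) ?_
    (Sum.elim (fun _ => ∅) val)
  · refine (congrFun h s).trans ?_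
    have hl : (S₁.sum S₂).l.filterMap Sum.getLeft? = S₁.l := by
      simp [System.sum, List.filterMap_append, List.filterMap_map, Function.comp_def]
    rw [hl, Sum.elim_comp_map]
    rfl
  · rintro q' - (q | y)
    · simp
    · simp

theorem System.value_sum_right {Q₁ Q₂ : Type} (S₁ : System.{u, v, w} Q₁ Var Act)
    (S₂ : System.{u, v, w} Q₂ Var Act) (K : Model.{v, z} Act)
    (val : Var → Set K.Point) (s : Q₂ ⊕ Var) :
    (S₁.sum S₂).value K val (Sum.map .inr id s) = S₂.value K val s := by
  have h := nest_simulation (X := Set K.Point)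
    (D' := fun q => evalStep K ((S₁.sum S₂).owner q) ((S₁.sum S₂).δ q))
    (D := fun q => evalStep K (S₂.owner q) (S₂.δ q))
    (ap₀' := fun q F => approx ((S₁.sum S₂).fixOwner q) F ((S₁.sum S₂).bound q))
    (ap₀ := fun q F => approx (S₂.fixOwner q) F (S₂.bound q))
    (ap' := fun q F => approx ((S₁.sum S₂).fixOwner q) F ((S₁.sum S₂).bound q))
    (ap := fun q F => approx (S₂.fixOwner q) F (S₂.bound q)) (f := Sum.inr)
    (g := (Sum.map .inr id : Q₂ ⊕ Var → (Q₁ ⊕ Q₂) ⊕ Var)) (pf := Sum.getRight?)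
    (fun q q' => by rw [Sum.getRight?_eq_some_iff, eq_comm])
    (fun q e' => evalStep_map _ _ _ _) (fun q => rfl) (fun q => rfl) (l := (S₁.sum S₂).l) ?_
    (Sum.elim (fun _ => ∅) val)
  · refine (congrFun h s).trans ?_
    have hl : (S₁.sum S₂).l.filterMap Sum.getRight? = S₂.l := by
      simp [System.sum, List.filterMap_append, List.filterMap_map, Function.comp_def]
    rw [hl, Sum.elim_comp_map]
    rfl
  · rintro q' - (q | y)
    · simp
    · simp

/-- With no variable bound, the old states never refer to the new one. -/
theorem System.value_extend_bindVars {P P' : Player} {a : WithTop Ordinal.{w}}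
    {d : Finset (Q ⊕ Var) ⊕ (Act × (Q ⊕ Var))} (K : Model.{v, z} Act)
    (val : Var → Set K.Point) (s : Q ⊕ Var) :
    (S.extend ∅ P P' a d).value K val (bindVars ∅ s) = S.value K val s := by
  rw [System.value, System.solve, show (S.extend ∅ P P' a d).l = none :: S.l.map some from rfl,
    nest_cons]
  refine (congrFun (S.solve_extend K _) s).trans ?_
  rw [update_comp_bindVars, System.value]
  simp

/-- The value of a new state that binds no variable and has a standard rank. -/
theorem System.value_extend_empty {P : Player}
    {d : Finset (Q ⊕ Var) ⊕ (Act × (Q ⊕ Var))} (K : Model.{v, z} Act)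
    (val : Var → Set K.Point) :
    (S.extend ∅ P P ⊤ d).value K val (.inl none) = evalStep K P d (S.value K val) := by
  rw [S.value_extend_none]
  simp [approx_const_top]

theorem ScalarFormula.hasSystem_fix {φ : ScalarFormula.{u, v, w} Var Act}
    (h : ScalarFormula.HasSystem.{u, v, w, z} φ) (P : Player) (a : WithTop Ordinal.{w})
    (x : Var) : ScalarFormula.HasSystem.{u, v, w, z} (.fix P a x φ) := by
  obtain ⟨_, S, s, h⟩ := h
  refine ⟨_, S.extend {x} P P a (.inl {s}), .inl none, fun K val => ?_⟩
  rw [S.value_extend_none, ScalarFormula.sem_fix]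
  congr 1
  ext1 H
  rw [evalStep_singleton, h]
  congr 1
  ext1 y
  by_cases hy : y = x
  · subst hy; simp
  · simp [hy]

/-- A fixpoint formula becomes a new highest state that binds its variable. Other connectives become
new states binding nothing, with bound ∞: the fixpoint of a constant map is its value, so these
states add only one transition. Subformulas are combined by disjoint union. -/
theorem ScalarFormula.hasSystem (φ : ScalarFormula.{u, v, w} Var Act) :
    ScalarFormula.HasSystem.{u, v, w, z} φ := by
  induction φ with
  | var x => exact ⟨_, .empty, .inr x, fun K val => rfl⟩
  | top =>
    refine ⟨_, System.empty.extend ∅ .adam .adam ⊤ (.inl ∅), .inl none, fun K val => ?_⟩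
    rw [System.value_extend_empty]
    ext m
    simp [mem_evalStep_adam_inl, ScalarFormula.sem]
  | bot =>
    refine ⟨_, System.empty.extend ∅ .eve .eve ⊤ (.inl ∅), .inl none, fun K val => ?_⟩
    rw [System.value_extend_empty]
    ext m
    simp [mem_evalStep_eve_inl, ScalarFormula.sem]
  | or φ ψ hφ hψ =>
    obtain ⟨_, S₁, s₁, h₁⟩ := hφ
    obtain ⟨_, S₂, s₂, h₂⟩ := hψ
    refine ⟨_, (S₁.sum S₂).extend ∅ .eve .eve ⊤ (.inl {Sum.map .inl id s₁, Sum.map .inr id s₂}),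
      .inl none, fun K val => ?_⟩
    rw [System.value_extend_empty]
    ext m
    simp [mem_evalStep_eve_inl, ScalarFormula.sem, S₁.value_sum_left, S₁.value_sum_right, h₁, h₂]
  | and φ ψ hφ hψ =>
    obtain ⟨_, S₁, s₁, h₁⟩ := hφ
    obtain ⟨_, S₂, s₂, h₂⟩ := hψ
    refine ⟨_, (S₁.sum S₂).extend ∅ .adam .adam ⊤ (.inl {Sum.map .inl id s₁, Sum.map .inr id s₂}),
      .inl none, fun K val => ?_⟩
    rw [System.value_extend_empty]
    ext m
    simp [mem_evalStep_adam_inl, ScalarFormula.sem, S₁.value_sum_left, S₁.value_sum_right, h₁, h₂]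
  | mu a x φ h => exact ScalarFormula.hasSystem_fix h .eve a x
  | nu a x φ h => exact ScalarFormula.hasSystem_fix h .adam a x
  | dia τ φ h =>
    obtain ⟨_, S, s, h⟩ := h
    refine ⟨_, S.extend ∅ .eve .eve ⊤ (.inr (τ, s)), .inl none, fun K val => ?_⟩
    rw [System.value_extend_empty]
    ext m
    simp only [evalStep, Moves, ScalarFormula.sem, ← h]
    aesop
  | box τ φ h =>
    obtain ⟨_, S, s, h⟩ := h
    refine ⟨_, S.extend ∅ .adam .adam ⊤ (.inr (τ, s)), .inl none, fun K val => ?_⟩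
    rw [System.value_extend_empty]
    ext m
    simp only [evalStep, Moves, ScalarFormula.sem, ← h]
    aesop

theorem ScalarFormula.exists_automaton (φ : ScalarFormula.{u, v, w} Var Act) :
    ∃ A : Automaton.{u, v, w} Var Act, A.InjectivelyRanked ∧
      ∀ (K : Model.{v, z} Act) (val : Var → Set K.Point), φ.sem K val = A.language K val := by
  obtain ⟨_, S, s, h⟩ := ScalarFormula.hasSystem.{u, v, w, z} φ
  -- The game starts in a positional configuration, so the initial state is not counted down first;
  -- starting at a state with bound α would give F(F^α) instead of F^α. An extra initial state with
  -- a single `ε`-transition to `s` repairs this, and also covers the case that `s` is a variable.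
  refine ⟨(S.extend ∅ .eve .eve ⊤ (.inl {s})).toAutomaton none,
    System.injectivelyRanked_toAutomaton _, fun K val => ?_⟩
  rw [System.language_toAutomaton]
  refine Eq.trans ?_ (evalStep_map .eve (.inl {s}) (bindVars ∅) _).symm
  rw [evalStep_singleton]
  exact (h K val).symm.trans (S.value_extend_bindVars K val s).symm

end ToAutomaton

end Countdown

theorem mainTheorem3 {Var : Type u} [Infinite Var] {Act : Type v} :
    (∀ φ : Countdown.ScalarFormula.{u, v, w} Var Act,
      ∃ A : Countdown.Automaton.{u, v, w} Var Act, A.InjectivelyRanked ∧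
        ∀ (K : Countdown.Model.{v, z} Act) (val : Var → Set K.Point),
          φ.sem K val = A.language K val) ∧
    (∀ A : Countdown.Automaton.{u, v, w} Var Act, A.InjectivelyRanked →
      ∃ φ : Countdown.ScalarFormula.{u, v, w} Var Act,
        ∀ (K : Countdown.Model.{v, z} Act) (val : Var → Set K.Point),
          φ.sem K val = A.language K val) :=
  ⟨Countdown.ScalarFormula.exists_automaton, Countdown.Automaton.exists_formula⟩
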